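/- Let $(W,S)$ be a Coxeter system with $W$ finite, length function $\ell$, Bruhat order $\prec$ and longest element $w_0$. Let $\mathcal H$ be its Hecke algebra: the free $\mathbb Z[q,q^{-1}]$-module with basis $(H_w)_{w\in W}$ and the associative product determined by $H_xH_y=H_{xy}$ if $\ell(xy)=\ell(x)+\ell(y)$, and $H_xH_s=H_{xs}+(q^{-1}-q)H_x$ if $s\in S$ and $\ell(xs)=\ell(x)-1$. Let $h\mapsto\bar h$ be the bar involution, given by $\bar q=q^{-1}$ and $\overline{H_x}=(H_{x^{-1}})^{-1}$. For each $x\in W$ there is a unique element $B_x\in\mathcal H$ with $\overline{B_x}=B_x$ and $B_x\in H_x+\sum_{y}q^{-1}\mathbb Z[q^{-1}]H_y$ (the canonical, or Kazhdan–Lusztig, basis of $\mathcal H$). Let $\mathcal H^*=\operatorname{Hom}_{\mathbb Z[q,q^{-1}]}(\mathcal H,\mathbb Z[q,q^{-1}])$, with the standard basis $(S_w)_{w\in W}$ defined by $\langle S_w,H_x\rangle=(-1)^{\ell(w)}\delta_{w,x}$ and the bar involution $\bar f(h)=\overline{f(\bar h)}$. For each $w\in W$ there is a unique element $D_w\in\mathcal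 H^*$ with $\overline{D_w}=D_w$ and $D_w\in S_w+\sum_{v\succ w}q^{-1}\mathbb Z[q^{-1}]S_v$ (the canonical basis of $\mathcal H^*$). Let $\operatorname{flip}\colon\mathcal H\to\mathcal H$ be the $\mathbb Z[q,q^{-1}]$-linear map with $\operatorname{flip}(H_w)=H_{w_0w}$. Then: 1. under the linear identification $\mathcal H\cong\mathcal H^*$, $H_w\mapsto S_w$, the element $\operatorname{flip}(B_{w_0w})$ is equal to $D_w$ for every $w\in W$; 2. for the bilinear pairing on $\mathcal H$ given by $\langle H_x,H_y\rangle=(-1)^{\ell(x)}\delta_{x,y}$, one has $\langle\operatorname{flip}(B_{w_0w}),B_x\rangle=(-1)^{\ell(x)}\delta_{x,w}$ for all $w,x\in W$. -/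

import Mathlib

namespace HeckeDuality

noncomputable section

variable {B W : Type*} [Group W] {M : CoxeterMatrix B} (cs : CoxeterSystem M W)

/-! ### The exchange property -/

/-- The action of a simple reflection on pairs (group element, parity), used for the exchange
property. -/
def flipLetter (i : B) : Function.End (W × ZMod 2) := by
  classical
  exact fun p => (cs.simple i * p.1 * cs.simple i, p.2 + if p.1 = cs.simple i then 1 else 0)

open Classical in
theorem flipLetter_apply (i : B) (p : W × ZMod 2) :
    flipLetter cs i p =
      (cs.simple i * p.1 * cs.simple i, p.2 + if p.1 = cs.simple i then 1 else 0) := rfl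

theorem rot_shift (i j : B) (k : ℕ) :
    cs.simple j * (cs.simple i * cs.simple j) ^ k * cs.simple j *
      (cs.simple i * cs.simple j) ^ k = 1 := by
  induction k with
  | zero => simp
  | succ k ih =>
    have h : cs.simple j * (cs.simple i * cs.simple j) ^ (k + 1) * cs.simple j *
        (cs.simple i * cs.simple j) ^ (k + 1) =
        cs.simple j * (cs.simple i * cs.simple j) ^ k * (cs.simple i * cs.simple j) * cs.simple j *
        ((cs.simple i * cs.simple j) * (cs.simple i * cs.simple j) ^ k) := by
      rw [← pow_succ', mul_assoc (cs.simple j) (_ ^ k), ← pow_succ]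
    rw [h]
    have h2 : ∀ a b : W, a * (cs.simple i * cs.simple j) * cs.simple j *
        ((cs.simple i * cs.simple j) * b) = a * cs.simple j * b := by
      intro a b
      simp [mul_assoc]
    rw [h2]
    exact ih

theorem rot_inv (i j : B) (k : ℕ) :
    ((cs.simple i * cs.simple j) ^ k)⁻¹ =
      cs.simple j * (cs.simple i * cs.simple j) ^ k * cs.simple j := by
  rw [eq_comm]
  exact eq_inv_of_mul_eq_one_left (rot_shift cs i j k)

open Classical in
theorem flipLetter_mul_pow (i j : B) (n : ℕ) (p : W × ZMod 2) :
    ((flipLetter cs i * flipLetter cs j) ^ n) p =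
      ((cs.simple i * cs.simple j) ^ n * p.1 * ((cs.simple i * cs.simple j) ^ n)⁻¹,
        p.2 + ∑ k ∈ Finset.range (2 * n),
          if p.1 = cs.simple j * (cs.simple i * cs.simple j) ^ k then 1 else 0) := by
  induction n with
  | zero => simp; rfl
  | succ n ih =>
    rw [pow_succ']
    change flipLetter cs i (flipLetter cs j (((flipLetter cs i * flipLetter cs j) ^ n) p)) = _
    rw [ih]
    obtain ⟨t, e⟩ := p
    set r := cs.simple i * cs.simple j with hr
    have hinv : (r ^ n)⁻¹ = cs.simple j * r ^ n * cs.simple j := rot_inv cs i j n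
    have e1 : (r ^ n * t * (r ^ n)⁻¹ = cs.simple j) ↔ t = cs.simple j * r ^ (2 * n) := by
      rw [mul_inv_eq_iff_eq_mul, ← eq_inv_mul_iff_mul_eq, hinv, two_mul, pow_add]
      simp [mul_assoc]
    have e2 : (cs.simple j * (r ^ n * t * (r ^ n)⁻¹) * cs.simple j = cs.simple i) ↔
        t = cs.simple j * r ^ (2 * n + 1) := by
      have h1 : cs.simple j * (r ^ n * t * (r ^ n)⁻¹) * cs.simple j =
        (cs.simple j * r ^ n) * t * (cs.simple j * r ^ n)⁻¹ := by
        simp [mul_assoc]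
      rw [h1, mul_inv_eq_iff_eq_mul, ← eq_inv_mul_iff_mul_eq, mul_inv_rev, hinv,
        show 2 * n + 1 = n + 1 + n by ring, pow_add, pow_succ]
      simp [mul_assoc, hr]
    rw [flipLetter_apply, flipLetter_apply]
    refine Prod.ext ?_ ?_
    · simp only [pow_succ', mul_inv_rev, hr, mul_assoc, cs.inv_simple]
    · simp only [e1, e2]
      rw [show 2 * (n + 1) = 2 * n + 1 + 1 by ring, Finset.sum_range_succ, Finset.sum_range_succ]
      ring

theorem flipLetter_liftable : M.IsLiftable (flipLetter cs) := by
  classical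
  intro i j
  funext p
  rw [flipLetter_mul_pow, cs.simple_mul_simple_pow]
  refine Prod.ext (by simp; rfl) ?_
  change _ = p.2
  have h : ∀ k, (cs.simple i * cs.simple j) ^ (M i j + k) = (cs.simple i * cs.simple j) ^ k := by
    intro k
    rw [pow_add, cs.simple_mul_simple_pow, one_mul]
  simp only [two_mul, Finset.sum_range_add, h]
  rw [← two_mul, show (2 : ZMod 2) = 0 from rfl, zero_mul, add_zero]

open Classical in
theorem flipLetter_word (ω : List B) (p : W × ZMod 2) :
    cs.lift ⟨flipLetter cs, flipLetter_liftable cs⟩ (cs.wordProd ω) p =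
      (cs.wordProd ω * p.1 * (cs.wordProd ω)⁻¹,
        p.2 + ((cs.rightInvSeq ω).count p.1 : ZMod 2)) := by
  induction ω with
  | nil => simp; rfl
  | cons i ω ih =>
    rw [cs.wordProd_cons, map_mul, cs.lift_apply_simple]
    change flipLetter cs i (cs.lift ⟨flipLetter cs, flipLetter_liftable cs⟩ (cs.wordProd ω) p) = _
    rw [ih, flipLetter_apply]
    refine Prod.ext ?_ ?_
    · simp [mul_assoc]
    · have e : (cs.wordProd ω * p.1 * (cs.wordProd ω)⁻¹ = cs.simple i) ↔
          ((cs.wordProd ω)⁻¹ * cs.simple i * cs.wordProd ω = p.1) := by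
        rw [mul_inv_eq_iff_eq_mul, ← eq_inv_mul_iff_mul_eq, mul_assoc, eq_comm]
      simp only [CoxeterSystem.rightInvSeq, List.count_cons, e, beq_iff_eq]
      push_cast
      ring

/-- Exchange property, in terms of right inversion sequences. -/
theorem mem_rightInvSeq_of_descent (ω : List B) (j : B)
    (h : cs.length (cs.wordProd ω * cs.simple j) < cs.length (cs.wordProd ω)) :
    cs.simple j ∈ cs.rightInvSeq ω := by
  classical
  obtain ⟨ν, hν, hνw⟩ := cs.exists_isReduced (cs.wordProd ω * cs.simple j)
  have hw : cs.wordProd (ν.concat j) = cs.wordProd ω := by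
    rw [cs.wordProd_concat, ← hνw]; simp
  have hred : cs.IsReduced (ν.concat j) := by
    have h1 := cs.length_wordProd_le (ν.concat j)
    have h2 : cs.length (cs.wordProd ω * cs.simple j) = ν.length := by rw [hνw]; exact hν
    unfold CoxeterSystem.IsReduced
    rw [hw] at h1 ⊢
    simp only [List.length_concat] at h1 ⊢
    omega
  have hc : (cs.rightInvSeq (ν.concat j)).count (cs.simple j) = 1 :=
    List.count_eq_one_of_mem hred.nodup_rightInvSeq (by rw [cs.rightInvSeq_concat]; simp)
  have k1 := flipLetter_word cs ω (cs.simple j, 0)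
  have k2 := flipLetter_word cs (ν.concat j) (cs.simple j, 0)
  rw [hw, k1] at k2
  have k3 := congrArg Prod.snd k2
  simp only [hc, zero_add] at k3
  by_contra hmem
  rw [List.count_eq_zero_of_not_mem hmem] at k3
  exact absurd k3 (by decide)

theorem simple_mul_eq_aux (w : W) (i j : B) (h1 : cs.length w < cs.length (cs.simple i * w))
    (h2 : cs.length w < cs.length (w * cs.simple j))
    (h3 : cs.length (cs.simple i * w * cs.simple j) = cs.length w) :
    cs.simple i * w = w * cs.simple j := by
  obtain ⟨ω, hω, rfl⟩ := cs.exists_isReduced w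
  have hm : cs.simple j ∈ cs.rightInvSeq (i :: ω) := by
    apply mem_rightInvSeq_of_descent
    rw [cs.wordProd_cons, h3]
    exact h1
  rw [CoxeterSystem.rightInvSeq, List.mem_cons] at hm
  rcases hm with hm | hm
  · rw [hm]; simp [mul_assoc]
  · have := (cs.isRightInversion_of_mem_rightInvSeq hω hm).2
    omega

theorem simple_mul_eq_mul_simple (w : W) (i j : B)
    (h1 : cs.length (cs.simple i * w) = cs.length (w * cs.simple j))
    (h2 : cs.length (cs.simple i * w * cs.simple j) = cs.length w) :
    cs.simple i * w = w * cs.simple j := by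
  rcases cs.length_simple_mul w i with h | h
  · exact simple_mul_eq_aux cs w i j (by omega) (by omega) h2
  · have := simple_mul_eq_aux cs (cs.simple i * w) i j (by simp; omega) (by omega)
      (by simp; omega)
    rw [cs.simple_mul_simple_cancel_left] at this
    calc cs.simple i * w = cs.simple i * (cs.simple i * w * cs.simple j) := by rw [← this]
      _ = w * cs.simple j := by simp [mul_assoc]

/-! ### The Hecke algebra -/

/-- The ground ring `ℤ[q, q⁻¹]`; the indeterminate `q` is `LaurentPolynomial.T 1`. -/
abbrev Scalars : Type := LaurentPolynomial ℤ

/-- The parameter `q⁻¹ - q`. -/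
def qParam : Scalars := LaurentPolynomial.T (-1) - LaurentPolynomial.T 1

/-- The Hecke algebra of a Coxeter system: the free `ℤ[q, q⁻¹]`-module on `W`, with the
multiplication given by the instance `HeckeAlgebra.instRing` below. -/
def HeckeAlgebra {B W : Type*} [Group W] {M : CoxeterMatrix B} (_cs : CoxeterSystem M W) : Type _ :=
  W →₀ Scalars

instance HeckeAlgebra.instAddCommGroup : AddCommGroup (HeckeAlgebra cs) :=
  inferInstanceAs (AddCommGroup (W →₀ Scalars))

instance HeckeAlgebra.instModule : Module Scalars (HeckeAlgebra cs) :=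
  inferInstanceAs (Module Scalars (W →₀ Scalars))

/-- The standard basis `(H_w)`. -/
def stdBasis : Module.Basis W Scalars (HeckeAlgebra cs) :=
  Module.Basis.ofRepr (LinearEquiv.refl Scalars (W →₀ Scalars))

/-- The standard basis element `H_w`. -/
def stdElt (w : W) : HeckeAlgebra cs := stdBasis cs w

/-- Left multiplication by `H_s` on the standard basis. -/
def leftOp (i : B) : HeckeAlgebra cs →ₗ[Scalars] HeckeAlgebra cs :=
  (stdBasis cs).constr Scalars fun w =>
    if cs.length w < cs.length (cs.simple i * w) then stdElt cs (cs.simple i * w)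
    else stdElt cs (cs.simple i * w) + qParam • stdElt cs w

/-- Right multiplication by `H_s` on the standard basis. -/
def rightOp (i : B) : HeckeAlgebra cs →ₗ[Scalars] HeckeAlgebra cs :=
  (stdBasis cs).constr Scalars fun w =>
    if cs.length w < cs.length (w * cs.simple i) then stdElt cs (w * cs.simple i)
    else stdElt cs (w * cs.simple i) + qParam • stdElt cs w

theorem leftOp_stdElt (i : B) (w : W) : leftOp cs i (stdElt cs w) =
    if cs.length w < cs.length (cs.simple i * w) then stdElt cs (cs.simple i * w)
    else stdElt cs (cs.simple i * w) + qParam • stdElt cs w :=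
  (stdBasis cs).constr_basis Scalars _ w

theorem rightOp_stdElt (i : B) (w : W) : rightOp cs i (stdElt cs w) =
    if cs.length w < cs.length (w * cs.simple i) then stdElt cs (w * cs.simple i)
    else stdElt cs (w * cs.simple i) + qParam • stdElt cs w :=
  (stdBasis cs).constr_basis Scalars _ w

theorem leftOp_rightOp_stdElt (i j : B) (w : W) :
    leftOp cs i (rightOp cs j (stdElt cs w)) = rightOp cs j (leftOp cs i (stdElt cs w)) := by
  have hA := cs.length_simple_mul w i
  have hB := cs.length_mul_simple w j
  have hC := cs.length_simple_mul (w * cs.simple j) i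
  have hD := cs.length_mul_simple (cs.simple i * w) j
  rw [← mul_assoc] at hC
  have key := simple_mul_eq_mul_simple cs w i j
  have hadd : ∀ a b c : HeckeAlgebra cs, a + b + c = a + c + b := fun a b c => add_right_comm a b c
  rw [rightOp_stdElt, leftOp_stdElt]
  by_cases h1 : cs.length w < cs.length (w * cs.simple j) <;>
  by_cases h2 : cs.length w < cs.length (cs.simple i * w) <;>
  by_cases h3 : cs.length (w * cs.simple j) < cs.length (cs.simple i * w * cs.simple j) <;>
  by_cases h4 : cs.length (cs.simple i * w) < cs.length (cs.simple i * w * cs.simple j) <;>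
  simp only [h1, h2, h3, h4, if_true, if_false, map_add, map_smul, leftOp_stdElt, rightOp_stdElt,
    ← mul_assoc] <;>
  first
  | (exfalso; omega)
  | done
  | (rw [key (by omega) (by omega)])
  | (simp only [smul_add, ← add_assoc]; rw [hadd (stdElt cs _)])

/-- Compositions of the operators `leftOp`. -/
def leftWord (ω : List B) : HeckeAlgebra cs →ₗ[Scalars] HeckeAlgebra cs :=
  ω.foldr (fun i f => leftOp cs i ∘ₗ f) LinearMap.id

theorem leftOp_comm (i j : B) (h : HeckeAlgebra cs) :
    leftOp cs i (rightOp cs j h) = rightOp cs j (leftOp cs i h) := by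
  have : leftOp cs i ∘ₗ rightOp cs j = rightOp cs j ∘ₗ leftOp cs i :=
    (stdBasis cs).ext fun w => leftOp_rightOp_stdElt cs i j w
  exact LinearMap.congr_fun this h

theorem leftWord_comm (ω : List B) (j : B) (h : HeckeAlgebra cs) :
    leftWord cs ω (rightOp cs j h) = rightOp cs j (leftWord cs ω h) := by
  induction ω with
  | nil => rfl
  | cons i ω ih =>
    change leftOp cs i (leftWord cs ω (rightOp cs j h)) =
      rightOp cs j (leftOp cs i (leftWord cs ω h))
    rw [ih, leftOp_comm]

theorem leftWord_one (ω : List B) (hω : cs.IsReduced ω) :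
    leftWord cs ω (stdElt cs 1) = stdElt cs (cs.wordProd ω) := by
  induction ω with
  | nil => simp [leftWord]
  | cons i ω ih =>
    have hω' : cs.IsReduced ω := by simpa using hω.drop 1
    change leftOp cs i (leftWord cs ω (stdElt cs 1)) = _
    have h1 : cs.length (cs.wordProd ω) = ω.length := hω'
    have h2 : cs.length (cs.wordProd (i :: ω)) = (i :: ω).length := hω
    rw [cs.wordProd_cons, List.length_cons] at h2
    rw [ih hω', leftOp_stdElt, if_pos (by omega), cs.wordProd_cons]

/-- A chosen reduced expression. -/
def redWord (w : W) : List B := (cs.exists_isReduced w).choose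

theorem redWord_isReduced (w : W) : cs.IsReduced (redWord cs w) :=
  (cs.exists_isReduced w).choose_spec.1

theorem wordProd_redWord (w : W) : cs.wordProd (redWord cs w) = w :=
  (cs.exists_isReduced w).choose_spec.2.symm

/-- Multiplication, as a bilinear map: `H_w` acts as `H_{s₁} ⋯ H_{sₖ}` for a reduced expression
`w = s₁ ⋯ sₖ` (see `stdElt_mul_of_length` and `stdElt_mul_simple` for the defining relations). -/
def mulMap : HeckeAlgebra cs →ₗ[Scalars] HeckeAlgebra cs →ₗ[Scalars] HeckeAlgebra cs :=
  (stdBasis cs).constr Scalars fun w => leftWord cs (redWord cs w)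

theorem mulMap_stdElt (w : W) : mulMap cs (stdElt cs w) = leftWord cs (redWord cs w) :=
  (stdBasis cs).constr_basis Scalars _ w

theorem mulMap_comm (a h : HeckeAlgebra cs) (j : B) :
    mulMap cs a (rightOp cs j h) = rightOp cs j (mulMap cs a h) := by
  have : (mulMap cs).compl₂ (rightOp cs j) = (mulMap cs).compr₂ (rightOp cs j) := by
    refine (stdBasis cs).ext fun w => LinearMap.ext fun h => ?_
    change mulMap cs (stdElt cs w) (rightOp cs j h) = rightOp cs j (mulMap cs (stdElt cs w) h)
    rw [mulMap_stdElt, leftWord_comm]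
  exact LinearMap.congr_fun (LinearMap.congr_fun this a) h

theorem mulMap_one (a : HeckeAlgebra cs) : mulMap cs a (stdElt cs 1) = a := by
  have : (mulMap cs).flip (stdElt cs 1) = LinearMap.id := by
    refine (stdBasis cs).ext fun w => ?_
    change mulMap cs (stdElt cs w) (stdElt cs 1) = stdElt cs w
    rw [mulMap_stdElt, leftWord_one cs _ (redWord_isReduced cs w), wordProd_redWord]
  exact LinearMap.congr_fun this a

/-- An operator that commutes with all right multiplications is determined by its value at `H_1`. -/
theorem eq_of_comm (f g : HeckeAlgebra cs →ₗ[Scalars] HeckeAlgebra cs)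
    (hf : ∀ j h, f (rightOp cs j h) = rightOp cs j (f h))
    (hg : ∀ j h, g (rightOp cs j h) = rightOp cs j (g h))
    (h1 : f (stdElt cs 1) = g (stdElt cs 1)) : f = g := by
  have main : ∀ (n : ℕ) (w : W), cs.length w = n → f (stdElt cs w) = g (stdElt cs w) := by
    intro n
    induction n with
    | zero =>
      intro w hw
      rw [cs.length_eq_zero_iff.mp hw, h1]
    | succ n ih =>
      intro w hw
      have hne : w ≠ 1 := by
        rintro rfl
        simp at hw
      obtain ⟨j, hj⟩ := cs.exists_rightDescent_of_ne_one hne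
      have hj' := cs.isRightDescent_iff.mp hj
      have hr : rightOp cs j (stdElt cs (w * cs.simple j)) = stdElt cs w := by
        rw [rightOp_stdElt, if_pos (by simp; omega)]
        simp
      rw [← hr, hf, hg, ih _ (by omega)]
  exact (stdBasis cs).ext fun w => main _ w rfl

instance HeckeAlgebra.instRing : Ring (HeckeAlgebra cs) :=
  { HeckeAlgebra.instAddCommGroup cs with
    mul := fun a b => mulMap cs a b
    one := stdElt cs 1
    left_distrib := fun a b c => (mulMap cs a).map_add b c
    right_distrib := fun a b c => (mulMap cs).map_add₂ a b c
    zero_mul := fun a => (mulMap cs).map_zero₂ a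
    mul_zero := fun a => (mulMap cs a).map_zero
    mul_one := fun a => mulMap_one cs a
    one_mul := fun a => by
      change mulMap cs (stdElt cs 1) a = a
      rw [eq_of_comm cs (mulMap cs (stdElt cs 1)) LinearMap.id
        (fun j h => mulMap_comm cs _ h j) (fun _ _ => rfl) (mulMap_one cs _)]
      rfl
    mul_assoc := fun a b c => by
      change mulMap cs (mulMap cs a b) c = mulMap cs a (mulMap cs b c)
      have := eq_of_comm cs (mulMap cs (mulMap cs a b)) (mulMap cs a ∘ₗ mulMap cs b)
        (fun j h => mulMap_comm cs _ h j)
        (fun j h => by simp only [LinearMap.comp_apply, mulMap_comm])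
        (by simp only [LinearMap.comp_apply, mulMap_one])
      exact LinearMap.congr_fun this c }

instance HeckeAlgebra.instAlgebra : Algebra Scalars (HeckeAlgebra cs) :=
  Algebra.ofModule (fun r a b => (mulMap cs).map_smul₂ r a b)
    (fun r a b => (mulMap cs a).map_smul r b)

theorem mul_def (a b : HeckeAlgebra cs) : a * b = mulMap cs a b := rfl

theorem stdElt_one : stdElt cs 1 = 1 := rfl

theorem mul_simple (a : HeckeAlgebra cs) (j : B) :
    a * stdElt cs (cs.simple j) = rightOp cs j a := by
  have h : rightOp cs j (stdElt cs 1) = stdElt cs (cs.simple j) := by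
    rw [rightOp_stdElt, if_pos (by simp)]
    simp
  rw [← h, mul_def, mulMap_comm, mulMap_one]

/-- The relation `H_x H_y = H_{xy}` if `ℓ(xy) = ℓ(x) + ℓ(y)`. -/
theorem stdElt_mul_of_length (x y : W) (h : cs.length (x * y) = cs.length x + cs.length y) :
    stdElt cs x * stdElt cs y = stdElt cs (x * y) := by
  induction hn : cs.length y generalizing y with
  | zero =>
    rw [cs.length_eq_zero_iff.mp hn, stdElt_one, mul_one, mul_one]
  | succ n ih =>
    have hne : y ≠ 1 := by
      rintro rfl
      simp at hn
    obtain ⟨j, hj⟩ := cs.exists_rightDescent_of_ne_one hne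
    have hj' := cs.isRightDescent_iff.mp hj
    have hxy := cs.length_mul_simple (x * y) j
    have hle := cs.length_mul_le x (y * cs.simple j)
    rw [← mul_assoc] at hle
    have hr : ∀ z : W, cs.length (z * cs.simple j) + 1 = cs.length z →
        stdElt cs (z * cs.simple j) * stdElt cs (cs.simple j) = stdElt cs z := by
      intro z hz
      rw [mul_simple, rightOp_stdElt, if_pos (by simp; omega)]
      simp
    rw [← hr y hj', ← mul_assoc, ih (y * cs.simple j) (by rw [← mul_assoc]; omega) (by omega),
      ← mul_assoc, hr (x * y) (by omega)]

/-- The relation `H_x H_s = H_{xs} + (q⁻¹ - q) H_x` if `ℓ(xs) = ℓ(x) - 1`. -/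
theorem stdElt_mul_simple (x : W) (j : B) (h : cs.length (x * cs.simple j) + 1 = cs.length x) :
    stdElt cs x * stdElt cs (cs.simple j) =
      stdElt cs (x * cs.simple j) + qParam • stdElt cs x := by
  rw [mul_simple, rightOp_stdElt, if_neg (by omega)]

theorem isUnit_stdElt_simple (j : B) : IsUnit (stdElt cs (cs.simple j)) := by
  have h := stdElt_mul_simple cs (cs.simple j) j (by simp)
  rw [cs.simple_mul_simple_self, stdElt_one] at h
  refine ⟨⟨stdElt cs (cs.simple j), stdElt cs (cs.simple j) - qParam • 1, ?_, ?_⟩, rfl⟩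
  · rw [mul_sub, h, mul_smul_comm, mul_one]; abel
  · rw [sub_mul, h, smul_mul_assoc, one_mul]; abel

/-- Every `H_w` is invertible. -/
theorem isUnit_stdElt (w : W) : IsUnit (stdElt cs w) := by
  induction hn : cs.length w generalizing w with
  | zero =>
    rw [cs.length_eq_zero_iff.mp hn]
    exact isUnit_one
  | succ n ih =>
    have hne : w ≠ 1 := by
      rintro rfl
      simp at hn
    obtain ⟨j, hj⟩ := cs.exists_rightDescent_of_ne_one hne
    have hj' := cs.isRightDescent_iff.mp hj
    have h := stdElt_mul_of_length cs (w * cs.simple j) (cs.simple j) (by simp; omega)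
    rw [cs.simple_mul_simple_cancel_right] at h
    rw [← h]
    exact (ih _ (by omega)).mul (isUnit_stdElt_simple cs j)

/-! ### Bar involutions and canonical bases -/

/-- The involution `q ↦ q⁻¹` of `ℤ[q, q⁻¹]`. -/
abbrev qBar : Scalars →+* Scalars :=
  ((LaurentPolynomial.invert (R := ℤ) : Scalars ≃ₐ[ℤ] Scalars) : Scalars →+* Scalars)

/-- The bar involution of the Hecke algebra: `q ↦ q⁻¹` and `H_x ↦ (H_{x⁻¹})⁻¹`. -/
def bar : HeckeAlgebra cs →ₛₗ[qBar] HeckeAlgebra cs where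
  toFun h := ((stdBasis cs).repr h).sum fun x c => qBar c • Ring.inverse (stdElt cs x⁻¹)
  map_add' a b := by
    rw [map_add]
    exact Finsupp.sum_add_index' (by simp) (by intro x c d; rw [map_add, add_smul])
  map_smul' r a := by
    rw [map_smul, Finsupp.sum_smul_index (by simp), Finsupp.smul_sum]
    simp only [map_mul, mul_smul]

theorem bar_smul_stdElt (c : Scalars) (x : W) :
    bar cs (c • stdElt cs x) = qBar c • Ring.inverse (stdElt cs x⁻¹) := by
  simp [bar, stdElt]

/-- The set `q⁻¹ℤ[q⁻¹]`. -/
def negPart : Set Scalars :=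
  {p | ∃ f : Polynomial ℤ, p = LaurentPolynomial.T (-1) *
    Polynomial.aeval (LaurentPolynomial.T (-1) : Scalars) f}

/-- `b` is a canonical (Kazhdan-Lusztig) basis element with leading term `H_x`: it is self-dual
and lies in `H_x + ∑_y q⁻¹ℤ[q⁻¹] H_y`. -/
def IsCanonical (x : W) (b : HeckeAlgebra cs) : Prop :=
  bar cs b = b ∧ ∀ y, (stdBasis cs).repr (b - stdElt cs x) y ∈ negPart

/-- The strict Bruhat order: `y ≠ x`, and some subword of some reduced expression of `x` is a
reduced expression of `y`. -/
def BruhatLT (y x : W) : Prop :=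
  y ≠ x ∧ ∃ ω ν : List B, cs.IsReduced ω ∧ cs.wordProd ω = x ∧ ν.Sublist ω ∧
    cs.IsReduced ν ∧ cs.wordProd ν = y

/-- The bar involution of the dual: `f̄(h)` is the bar of `f(h̄)`. -/
def dualBar (f : Module.Dual Scalars (HeckeAlgebra cs)) :
    Module.Dual Scalars (HeckeAlgebra cs) where
  toFun h := qBar (f (bar cs h))
  map_add' a b := by simp only [map_add]
  map_smul' r a := by
    rw [LinearMap.map_smulₛₗ, map_smul, smul_eq_mul, map_mul]
    simp [LaurentPolynomial.involutive_invert r]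

open Classical in
/-- The standard basis `(S_w)` of the dual, `⟨S_w, H_x⟩ = (-1)^{ℓ(w)} δ_{w,x}`. -/
def dualStdBasis [Finite W] :
    Module.Basis W Scalars (Module.Dual Scalars (HeckeAlgebra cs)) :=
  (stdBasis cs).dualBasis.unitsSMul fun w => (-1) ^ cs.length w

open Classical in
theorem dualStdBasis_apply [Finite W] (w x : W) :
    dualStdBasis cs w (stdElt cs x) = if w = x then (-1) ^ cs.length w else 0 := by
  rw [dualStdBasis, Module.Basis.unitsSMul_apply, LinearMap.smul_apply, stdElt,
    Module.Basis.dualBasis_apply_self]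
  simp [Units.smul_def, eq_comm]

/-- `d` is a canonical basis element of the dual with leading term `S_w`: it is self-dual and lies
in `S_w + ∑_{v ≻ w} q⁻¹ℤ[q⁻¹] S_v`. -/
def IsDualCanonical [Finite W] (w : W) (d : Module.Dual Scalars (HeckeAlgebra cs)) : Prop :=
  dualBar cs d = d ∧
    ∀ v, (BruhatLT cs w v → (dualStdBasis cs).repr (d - dualStdBasis cs w) v ∈ negPart) ∧
      (¬ BruhatLT cs w v → (dualStdBasis cs).repr (d - dualStdBasis cs w) v = 0)

/-- The identification `H_w ↦ S_w`. -/
def dualIdent [Finite W] :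
    HeckeAlgebra cs ≃ₗ[Scalars] Module.Dual Scalars (HeckeAlgebra cs) :=
  (stdBasis cs).equiv (dualStdBasis cs) (Equiv.refl W)

theorem dualIdent_stdElt [Finite W] (w : W) :
    dualIdent cs (stdElt cs w) = dualStdBasis cs w := by
  simp [dualIdent, stdElt]

/-- The linear map `H_w ↦ H_{uw}`; it is `flip` when `u` is the longest element. -/
def flip (u : W) : HeckeAlgebra cs →ₗ[Scalars] HeckeAlgebra cs :=
  (stdBasis cs).constr Scalars fun w => stdElt cs (u * w)

open Classical in
/-- The bilinear pairing `⟨H_x, H_y⟩ = (-1)^{ℓ(x)} δ_{x,y}`. -/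
def pairing : HeckeAlgebra cs →ₗ[Scalars] HeckeAlgebra cs →ₗ[Scalars] Scalars :=
  (stdBasis cs).constr Scalars fun x => (stdBasis cs).constr Scalars fun y =>
    if x = y then (-1) ^ cs.length x else 0

end

end HeckeDuality

namespace HeckeDuality

noncomputable section

/-! ### The set `q⁻¹ℤ[q⁻¹]` -/

/-! Both canonical bases come from one mechanism: a semilinear involution that is unitriangular in a
standard basis. A bar-invariant element of q⁻¹ℤ[q⁻¹] is zero, so a self-dual vector with all
coefficients there vanishes (`eq_zero_of_selfDual`); this gives uniqueness. Existence follows by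
correcting coefficients in order of decreasing rank (`exists_selfDual`). On the Hecke algebra,
unitriangularity comes from expanding along a reduced word (`bruhatLT_of_repr_bar_sub_ne_zero`). On
the dual, the bar matrix is the signed, barred transpose, hence triangular for the reversed order.

For statement 1, left multiplication by w₀ exchanges right ascents and descents. Together with the
signs in S_w this makes the flip carry right multiplication by H_s to minus the transpose of right
multiplication by H_s⁻¹ (`dualIdent_flip_rightOp`). Since S_{w₀}, the image of H_1, is self-dual,
induction on length shows that the flip commutes with the bars (`dualBar_dualIdent_flip`). Thus
flip(B_{w₀w}) is self-dual with leading term S_w, and uniqueness identifies it with D_w.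

For statement 2, ⟨D_w, B_x⟩ is bar-invariant and differs from the integer ⟨S_w, H_x⟩ by an element
of q⁻¹ℤ[q⁻¹], so the two agree (`dualCanonical_apply_canonical`).

The Coxeter input is strong exchange, obtained from a parity cocycle on reflections. It yields the
behaviour of w₀, reduced subwords and transitivity of the Bruhat order. -/

theorem zero_mem_negPart : (0 : Scalars) ∈ negPart := ⟨0, by simp⟩

theorem add_mem_negPart {p p' : Scalars} (hp : p ∈ negPart) (hp' : p' ∈ negPart) :
    p + p' ∈ negPart := by
  obtain ⟨f, rfl⟩ := hp
  obtain ⟨g, rfl⟩ := hp'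
  exact ⟨f + g, by rw [map_add, mul_add]⟩

theorem neg_mem_negPart {p : Scalars} (hp : p ∈ negPart) : -p ∈ negPart := by
  obtain ⟨f, rfl⟩ := hp
  exact ⟨-f, by rw [map_neg, mul_neg]⟩

theorem sub_mem_negPart {p p' : Scalars} (hp : p ∈ negPart) (hp' : p' ∈ negPart) :
    p - p' ∈ negPart := by
  rw [sub_eq_add_neg]
  exact add_mem_negPart hp (neg_mem_negPart hp')

theorem mul_mem_negPart {p p' : Scalars} (hp : p ∈ negPart) (hp' : p' ∈ negPart) :
    p * p' ∈ negPart := by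
  obtain ⟨f, rfl⟩ := hp
  obtain ⟨g, rfl⟩ := hp'
  refine ⟨f * Polynomial.X * g, ?_⟩
  rw [map_mul, map_mul, Polynomial.aeval_X]
  ring

theorem sum_mem_negPart {ι : Type*} (s : Finset ι) {f : ι → Scalars}
    (hf : ∀ i ∈ s, f i ∈ negPart) : ∑ i ∈ s, f i ∈ negPart :=
  Finset.sum_induction f (· ∈ negPart) (fun _ _ => add_mem_negPart) zero_mem_negPart hf

theorem neg_one_pow_mul_mem_negPart {p : Scalars} (hp : p ∈ negPart) (n : ℕ) :
    (-1) ^ n * p ∈ negPart := by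
  rcases neg_one_pow_eq_or Scalars n with h | h <;> rw [h]
  · rwa [one_mul]
  · rw [neg_one_mul]
    exact neg_mem_negPart hp

theorem C_mul_T_eq (k : ℕ) (r : ℤ) :
    LaurentPolynomial.T (-1) * Polynomial.aeval (LaurentPolynomial.T (-1) : Scalars)
      (Polynomial.monomial k r) = LaurentPolynomial.C r * LaurentPolynomial.T (-(k + 1 : ℤ)) := by
  rw [Polynomial.aeval_monomial, ← LaurentPolynomial.C_eq_algebraMap, LaurentPolynomial.T_pow,
    mul_left_comm, ← LaurentPolynomial.T_add]
  congr 2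
  ring

/-- Turns the polynomial witness into a condition on exponents, which `qBar` simply negates. -/
theorem mem_negPart_iff (p : Scalars) : p ∈ negPart ↔ ∀ n : ℤ, 0 ≤ n → p.coeff n = 0 := by
  constructor
  · rintro ⟨f, rfl⟩ n hn
    induction f using Polynomial.induction_on' with
    | add f g hf hg => rw [map_add, mul_add, AddMonoidAlgebra.coeff_add, Finsupp.add_apply, hf, hg,
        add_zero]
    | monomial k r =>
      rw [C_mul_T_eq, ← LaurentPolynomial.single_eq_C_mul_T, AddMonoidAlgebra.coeff_single,
        Finsupp.single_apply, if_neg (by omega)]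
  · intro h
    have hp : p = ∑ n ∈ p.coeff.support, AddMonoidAlgebra.single n (p.coeff n) :=
      (AddMonoidAlgebra.sum_coeff_single p).symm
    rw [hp]
    refine sum_mem_negPart _ fun n hn => ?_
    have hneg : n < 0 := by
      by_contra hc
      exact Finsupp.mem_support_iff.mp hn (h n (by omega))
    obtain ⟨k, rfl⟩ : ∃ k : ℕ, n = -(k + 1 : ℤ) := ⟨(-n - 1).toNat, by omega⟩
    rw [LaurentPolynomial.single_eq_C_mul_T, ← C_mul_T_eq]
    exact ⟨_, rfl⟩

theorem coeff_qBar (p : Scalars) (n : ℤ) : (qBar p).coeff n = p.coeff (-n) :=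
  LaurentPolynomial.invert_apply p n

theorem qBar_qBar (p : Scalars) : qBar (qBar p) = p := LaurentPolynomial.involutive_invert p

theorem eq_zero_of_qBar_eq_of_mem_negPart {p : Scalars} (hp : p ∈ negPart) (h : qBar p = p) :
    p = 0 := by
  rw [mem_negPart_iff] at hp
  refine LaurentPolynomial.ext fun n => ?_
  rcases le_total 0 n with hn | hn
  · exact hp n hn
  · rw [← h, coeff_qBar]
    exact hp _ (by omega)

theorem exists_sub_qBar_eq {a : Scalars} (h : qBar a = -a) : ∃ p ∈ negPart, p - qBar p = a := by
  have ha : ∀ n, a.coeff (-n) = - a.coeff n := fun n => by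
    rw [← coeff_qBar, h]
    rfl
  let p : Scalars := AddMonoidAlgebra.ofCoeff (a.coeff.filter (· < 0))
  have hp : ∀ n, p.coeff n = if n < 0 then a.coeff n else 0 := fun n => Finsupp.filter_apply _ _ _
  -- Here `p` is the negative-exponent part of `a`. Antisymmetry recovers the positive part from
  -- `-qBar p` and kills the constant coefficient, since ℤ has no 2-torsion.
  refine ⟨p, (mem_negPart_iff p).mpr fun n hn => by rw [hp, if_neg (by omega)], ?_⟩
  refine LaurentPolynomial.ext fun n => ?_
  rw [AddMonoidAlgebra.coeff_sub, Finsupp.sub_apply, coeff_qBar, hp, hp]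
  rcases lt_trichotomy n 0 with hn | rfl | hn
  · rw [if_pos hn, if_neg (by omega), sub_zero]
  · have := ha 0
    rw [neg_zero] at this
    simp only [neg_zero, lt_self_iff_false, if_false]
    omega
  · rw [if_neg (by omega), if_pos (by omega), ha]
    ring

/-! ### Unitriangular semilinear involutions -/

section Triangular

variable {ι V : Type*} [AddCommGroup V] [Module Scalars V]

/-- Separates the diagonal contribution from the off-diagonal one, so that unitriangularity can
remove the sum at a coefficient of top rank. -/
theorem repr_bar_apply [Fintype ι] (b : Module.Basis ι Scalars V) (ψ : V →ₛₗ[qBar] V) (m : V)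
    (y : ι) : b.repr (ψ m) y = qBar (b.repr m y) +
      ∑ z, qBar (b.repr m z) * b.repr (ψ (b z) - b z) y := by
  classical
  have h : ψ m = ∑ z, qBar (b.repr m z) • b z + ∑ z, qBar (b.repr m z) • (ψ (b z) - b z) := by
    rw [← Finset.sum_add_distrib]
    conv_lhs => rw [← b.sum_repr m, map_sum]
    refine Finset.sum_congr rfl fun z _ => ?_
    rw [LinearMap.map_smulₛₗ, ← smul_add, add_sub_cancel]
  rw [h, map_add, Finsupp.add_apply, b.repr_sum_self, map_sum, Finsupp.finsetSum_apply]
  simp only [map_smul, Finsupp.smul_apply, smul_eq_mul]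

/-- A self-dual element is zero if its coefficients lie in `q⁻¹ℤ[q⁻¹]`. -/
theorem eq_zero_of_selfDual [Finite ι] (b : Module.Basis ι Scalars V) (ψ : V →ₛₗ[qBar] V)
    (rank : ι → ℕ) (htri : ∀ x y, b.repr (ψ (b x) - b x) y ≠ 0 → rank y < rank x)
    (d : V) (hd : ψ d = d) (hneg : ∀ y, b.repr d y ∈ negPart) : d = 0 := by
  classical
  have := Fintype.ofFinite ι
  by_contra hne
  have hsupp : (b.repr d).support.Nonempty := by
    rw [Finsupp.support_nonempty_iff]
    exact fun h => hne (b.repr.map_eq_zero_iff.mp h)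
  -- At a support element of maximal rank no other term contributes, so the coefficient there is
  -- bar-invariant.
  obtain ⟨y, hy, hmax⟩ := Finset.exists_max_image _ rank hsupp
  refine Finsupp.mem_support_iff.mp hy (eq_zero_of_qBar_eq_of_mem_negPart (hneg y) ?_)
  have key := repr_bar_apply b ψ d y
  rw [hd, Finset.sum_eq_zero, add_zero] at key
  · exact key.symm
  · intro z _
    by_contra hz
    have hz1 : b.repr d z ≠ 0 := by
      rintro h0
      rw [h0, map_zero, zero_mul] at hz
      exact hz rfl
    have := htri z y (right_ne_zero_of_mul hz)
    have := hmax z (Finsupp.mem_support_iff.mpr hz1)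
    omega

/-- Induction on a bound for the ranks in the support of an anti-self-dual `m`. Its top coefficients
are anti-invariant, hence of the form p - p̄ with p in q⁻¹ℤ[q⁻¹]; subtracting the corresponding n₀ -
ψ n₀ leaves only terms of smaller rank. The relation `r` is carried along to control the support of
the solution. -/
theorem exists_sub_bar_eq [Finite ι] (b : Module.Basis ι Scalars V) (ψ : V →ₛₗ[qBar] V)
    (hψ : ∀ v, ψ (ψ v) = v) (rank : ι → ℕ) (r : ι → ι → Prop)
    (hr : ∀ y x, r y x → rank y < rank x) (htrans : ∀ z y x, r z y → r y x → r z x)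
    (htri : ∀ x y, b.repr (ψ (b x) - b x) y ≠ 0 → r y x) (x : ι) (k : ℕ) (m : V)
    (hm : ψ m = -m) (hsupp : ∀ y, b.repr m y ≠ 0 → r y x ∧ rank y < k) :
    ∃ n : V, n - ψ n = m ∧ ∀ y, b.repr n y ∈ negPart ∧ (¬ r y x → b.repr n y = 0) := by
  classical
  have := Fintype.ofFinite ι
  induction k generalizing m with
  | zero =>
    have : m = 0 := b.ext_elem fun y => by
      rw [map_zero]
      by_contra h
      exact absurd (hsupp y h).2 (by omega)
    exact ⟨0, by rw [this, map_zero, sub_zero], fun y => by simp [zero_mem_negPart]⟩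
  | succ k ih =>
    have hanti : ∀ y, rank y = k → qBar (b.repr m y) = -(b.repr m y) := by
      intro y hy
      have key := repr_bar_apply b ψ m y
      rw [Finset.sum_eq_zero, add_zero, hm, map_neg, Finsupp.neg_apply] at key
      · exact key.symm
      · intro z _
        by_contra hz
        have hz1 : b.repr m z ≠ 0 := by
          rintro h0
          rw [h0, map_zero, zero_mul] at hz
          exact hz rfl
        have := hr _ _ (htri z y (right_ne_zero_of_mul hz))
        have := (hsupp z hz1).2
        omega
    -- Forcing `p = 0` where `m` has no coefficient keeps the support of the correction below `x`
    -- for `r`.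
    have hex : ∀ y, ∃ p ∈ negPart, (b.repr m y = 0 → p = 0) ∧
        (rank y = k → p - qBar p = b.repr m y) ∧ (rank y ≠ k → p = 0) := by
      intro y
      by_cases h0 : b.repr m y = 0
      · exact ⟨0, zero_mem_negPart, fun _ => rfl, fun _ => by rw [h0, map_zero, sub_zero],
          fun _ => rfl⟩
      by_cases hy : rank y = k
      · obtain ⟨p, hp, hp'⟩ := exists_sub_qBar_eq (hanti y hy)
        exact ⟨p, hp, fun h => absurd h h0, fun _ => hp', fun h => absurd hy h⟩
      · exact ⟨0, zero_mem_negPart, fun _ => rfl, fun h => absurd h hy, fun _ => rfl⟩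
    choose p hpneg hp0 hpk hpk' using hex
    have hrepr : ∀ y, b.repr (∑ z, p z • b z) y = p y := fun y => by rw [b.repr_sum_self]
    set n₀ := ∑ z, p z • b z
    have hbar : ∀ y, b.repr (m - (n₀ - ψ n₀)) y = b.repr m y - (p y - qBar (p y)) +
        ∑ z, qBar (p z) * b.repr (ψ (b z) - b z) y := by
      intro y
      simp only [map_sub, Finsupp.sub_apply, repr_bar_apply b ψ n₀ y, hrepr]
      ring
    obtain ⟨n, hn, hn'⟩ := ih (m - (n₀ - ψ n₀)) (by simp only [map_sub, hψ, hm]; abel) (by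
      intro y hy
      rw [hbar] at hy
      have hsum : (∑ z, qBar (p z) * b.repr (ψ (b z) - b z) y ≠ 0) → r y x ∧ rank y < k := by
        intro h
        obtain ⟨z, -, hz⟩ := Finset.exists_ne_zero_of_sum_ne_zero h
        have hpz : p z ≠ 0 := by
          rintro h0
          rw [h0, map_zero, zero_mul] at hz
          exact hz rfl
        have hzk : rank z = k := by
          by_contra hc
          exact hpz (hpk' z hc)
        have hyz := htri z y (right_ne_zero_of_mul hz)
        have hzx := (hsupp z fun h0 => hpz (hp0 z h0)).1
        exact ⟨htrans _ _ _ hyz hzx, hzk ▸ hr _ _ hyz⟩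
      by_cases hs : (∑ z, qBar (p z) * b.repr (ψ (b z) - b z) y) = 0
      · rw [hs, add_zero] at hy
        by_cases hyk : rank y = k
        · rw [hpk y hyk, sub_self] at hy
          exact absurd rfl hy
        · rw [hpk' y hyk, map_zero, sub_zero, sub_zero] at hy
          have := hsupp y hy
          exact ⟨this.1, by omega⟩
      · exact hsum hs)
    refine ⟨n + n₀, ?_, fun y => ⟨?_, fun hy => ?_⟩⟩
    · rw [map_add, add_sub_add_comm, hn, sub_add_cancel]
    · rw [map_add, Finsupp.add_apply, hrepr]
      exact add_mem_negPart (hn' y).1 (hpneg y)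
    · rw [map_add, Finsupp.add_apply, hrepr, (hn' y).2 hy, zero_add]
      refine hp0 y ?_
      by_contra h
      exact hy (hsupp y h).1

/-- Existence of canonical basis elements for a unitriangular semilinear involution. -/
theorem exists_selfDual [Finite ι] (b : Module.Basis ι Scalars V) (ψ : V →ₛₗ[qBar] V)
    (hψ : ∀ v, ψ (ψ v) = v) (rank : ι → ℕ) (r : ι → ι → Prop)
    (hr : ∀ y x, r y x → rank y < rank x) (htrans : ∀ z y x, r z y → r y x → r z x)
    (htri : ∀ x y, b.repr (ψ (b x) - b x) y ≠ 0 → r y x) (x : ι) :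
    ∃ c : V, ψ c = c ∧
      ∀ y, b.repr (c - b x) y ∈ negPart ∧ (¬ r y x → b.repr (c - b x) y = 0) := by
  -- The defect ψ(b x) - b x is anti-self-dual; writing it as n - ψ n makes b x + n self-dual.
  obtain ⟨n, hn, hn'⟩ := exists_sub_bar_eq b ψ hψ rank r hr htrans htri x (rank x)
    (ψ (b x) - b x) (by rw [map_sub, hψ, neg_sub])
    (fun y hy => ⟨htri x y hy, hr _ _ (htri x y hy)⟩)
  refine ⟨b x + n, ?_, fun y => by rw [add_sub_cancel_left]; exact hn' y⟩
  rw [sub_eq_sub_iff_add_eq_add] at hn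
  rw [map_add, ← hn, add_comm]

end Triangular

variable {B W : Type*} [Group W] {M : CoxeterMatrix B} (cs : CoxeterSystem M W)

/-! ### Strong exchange -/

/-- The parity of the number of times that a reflection `t` occurs in the right inversion sequence
of a word for `w`; it is `1` exactly if `ℓ(wt) < ℓ(w)`. -/
def inversionParity (w t : W) : ZMod 2 :=
  (cs.lift ⟨flipLetter cs, flipLetter_liftable cs⟩ w (t, 0)).2

open Classical in
theorem inversionParity_wordProd (ω : List B) (t : W) :
    inversionParity cs (cs.wordProd ω) t = ((cs.rightInvSeq ω).count t : ZMod 2) := by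
  rw [inversionParity, flipLetter_word, zero_add]

theorem lift_flipLetter_apply (w t : W) (e : ZMod 2) :
    cs.lift ⟨flipLetter cs, flipLetter_liftable cs⟩ w (t, e) =
      (w * t * w⁻¹, e + inversionParity cs w t) := by
  obtain ⟨ω, -, rfl⟩ := cs.exists_isReduced w
  rw [inversionParity_wordProd, flipLetter_word]

theorem inversionParity_one (t : W) : inversionParity cs 1 t = 0 := by
  rw [inversionParity, map_one]
  rfl

/-- The cocycle identity, read off from the action of `W` on pairs (element, parity). -/
theorem inversionParity_mul (u w t : W) : inversionParity cs (u * w) t =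
    inversionParity cs w t + inversionParity cs u (w * t * w⁻¹) := by
  rw [inversionParity, map_mul]
  change (cs.lift ⟨flipLetter cs, flipLetter_liftable cs⟩ u
    (cs.lift ⟨flipLetter cs, flipLetter_liftable cs⟩ w (t, 0))).2 = _
  rw [lift_flipLetter_apply, lift_flipLetter_apply, zero_add]

theorem inversionParity_simple_self (i : B) :
    inversionParity cs (cs.simple i) (cs.simple i) = 1 := by
  classical
  have := inversionParity_wordProd cs [i] (cs.simple i)
  rw [cs.wordProd_singleton] at this
  rw [this]
  simp

theorem inversionParity_self {t : W} (ht : cs.IsReflection t) : inversionParity cs t t = 1 := by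
  obtain ⟨w, i, rfl⟩ := ht
  -- For t = w s w⁻¹, the cocycle identity for w w⁻¹ = 1 shows that the contributions of w and w⁻¹
  -- cancel, leaving only that of s at s.
  have h := inversionParity_mul cs w w⁻¹ (w * cs.simple i * w⁻¹)
  have e : w⁻¹ * (w * cs.simple i * w⁻¹) * w⁻¹⁻¹ = cs.simple i := by group
  rw [mul_inv_cancel, inversionParity_one, e] at h
  rw [inversionParity_mul, inversionParity_mul, e, inversionParity_simple_self,
    cs.inv_simple, cs.simple_mul_simple_self, one_mul, add_left_comm, ← h, add_zero]

theorem inversionParity_eq_zero_or_one (w t : W) :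
    inversionParity cs w t = 0 ∨ inversionParity cs w t = 1 := by
  generalize inversionParity cs w t = a
  revert a
  decide

theorem length_mul_lt_of_inversionParity {w t : W} (h : inversionParity cs w t = 1) :
    cs.length (w * t) < cs.length w := by
  classical
  obtain ⟨ω, hω, rfl⟩ := cs.exists_isReduced w
  rw [inversionParity_wordProd] at h
  refine (cs.isRightInversion_of_mem_rightInvSeq hω ?_).2
  by_contra hmem
  rw [List.count_eq_zero_of_not_mem hmem] at h
  exact absurd h (by decide)

theorem inversionParity_eq_one_iff {w t : W} (ht : cs.IsReflection t) :
    inversionParity cs w t = 1 ↔ cs.length (w * t) < cs.length w := by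
  refine ⟨length_mul_lt_of_inversionParity cs, fun h => ?_⟩
  refine (inversionParity_eq_zero_or_one cs w t).resolve_left fun h0 => ?_
  -- Multiplying by `t` switches the parity, so parity zero at `w` would make `w` shorter than `w *
  -- t`.
  have h1 : inversionParity cs (w * t) t = 1 := by
    rw [inversionParity_mul, inversionParity_self cs ht, ht.inv, ht.mul_self, one_mul, h0,
      add_zero]
  have := length_mul_lt_of_inversionParity cs h1
  rw [mul_assoc, ht.mul_self, mul_one] at this
  omega

/-- Strong exchange: if `ℓ(wt) < ℓ(w)` for a reflection `t`, then `wt` is obtained from any word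
for `w` by deleting a letter. -/
theorem exists_eraseIdx_of_length_mul_lt (ω : List B) {t : W} (ht : cs.IsReflection t)
    (h : cs.length (cs.wordProd ω * t) < cs.length (cs.wordProd ω)) :
    ∃ j < ω.length, cs.wordProd (ω.eraseIdx j) = cs.wordProd ω * t := by
  classical
  have hmem : t ∈ cs.rightInvSeq ω := by
    rw [← inversionParity_eq_one_iff cs ht, inversionParity_wordProd] at h
    by_contra hmem
    rw [List.count_eq_zero_of_not_mem hmem] at h
    exact absurd h (by decide)
  obtain ⟨j, hj, hjt⟩ := List.getElem_of_mem hmem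
  refine ⟨j, by simpa using hj, ?_⟩
  rw [← cs.wordProd_mul_getD_rightInvSeq, List.getD_eq_getElem _ _ hj, hjt]

/-! ### The longest element -/

/-- Every reflection is a right inversion of w₀, so the cocycle identity makes the parity of w₀x at
s that of x plus one. -/
theorem length_longest_mul_mul_simple_lt_iff {w₀ : W}
    (hw₀ : ∀ w, cs.length w ≤ cs.length w₀) (x : W) (j : B) :
    cs.length (w₀ * x * cs.simple j) < cs.length (w₀ * x) ↔
      cs.length x < cs.length (x * cs.simple j) := by
  have hj := cs.isReflection_simple j
  have hr : cs.IsReflection (x * cs.simple j * x⁻¹) := hj.conj x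
  have h0 : inversionParity cs w₀ (x * cs.simple j * x⁻¹) = 1 :=
    (inversionParity_eq_one_iff cs hr).mpr (lt_of_le_of_ne (hw₀ _) (hr.length_mul_left_ne w₀))
  have h1 := inversionParity_eq_one_iff cs (w := x) hj
  have hne := cs.length_mul_simple_ne x j
  rw [← inversionParity_eq_one_iff cs hj, inversionParity_mul, h0]
  rcases inversionParity_eq_zero_or_one cs x (cs.simple j) with h | h <;> rw [h] at h1 ⊢
  · have : ¬ cs.length (x * cs.simple j) < cs.length x := fun hlt => absurd (h1.mpr hlt) (by decide)
    simp only [zero_add, true_iff]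
    omega
  · have := h1.mp rfl
    refine ⟨fun h => absurd h (by decide), fun h => by omega⟩

/-! ### The Bruhat order -/

/-- Built letter by letter: a letter that raises the length is kept, and one that lowers it is
traded, by exchange, for the deletion of an earlier letter. -/
theorem exists_isReduced_sublist (ω : List B) :
    ∃ ν : List B, ν.Sublist ω ∧ cs.IsReduced ν ∧ cs.wordProd ν = cs.wordProd ω := by
  induction ω using List.reverseRecOn with
  | nil => exact ⟨[], List.Sublist.refl _, by simp [CoxeterSystem.IsReduced], rfl⟩
  | append_singleton ω i ih =>
    obtain ⟨ν, hν, hred, hprod⟩ := ih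
    have hred' : cs.length (cs.wordProd ν) = ν.length := hred
    rcases cs.length_mul_simple (cs.wordProd ν) i with h | h
    · refine ⟨ν ++ [i], hν.append (List.Sublist.refl _), ?_, ?_⟩
      · rw [CoxeterSystem.IsReduced, cs.wordProd_append, cs.wordProd_singleton, h, hred']
        simp
      · rw [cs.wordProd_append, cs.wordProd_append, hprod]
    · obtain ⟨j, hj, hjp⟩ := exists_eraseIdx_of_length_mul_lt cs ν (cs.isReflection_simple i)
        (by omega)
      refine ⟨ν.eraseIdx j, (List.eraseIdx_sublist ν j).trans (hν.trans
        (List.sublist_append_left _ _)), ?_, ?_⟩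
      · rw [CoxeterSystem.IsReduced, hjp, List.length_eraseIdx_of_lt hj]
        omega
      · rw [hjp, cs.wordProd_append, cs.wordProd_singleton, hprod]

theorem bruhatLT_of_sublist {ω ν : List B} (hω : cs.IsReduced ω) (hν : ν.Sublist ω)
    (hlt : ν.length < ω.length) : BruhatLT cs (cs.wordProd ν) (cs.wordProd ω) := by
  obtain ⟨ν', hν', hred, hprod⟩ := exists_isReduced_sublist cs ν
  refine ⟨fun h => ?_, ω, ν', hω, rfl, hν'.trans hν, hred, hprod⟩
  have h1 := cs.length_wordProd_le ν
  rw [h, hω.eq] at h1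
  omega

theorem BruhatLT.length_lt {y x : W} (h : BruhatLT cs y x) : cs.length y < cs.length x := by
  obtain ⟨hne, ω, ν, hω, rfl, hν, hred, rfl⟩ := h
  rw [hω.eq, hred.eq]
  refine lt_of_le_of_ne hν.length_le fun h => hne ?_
  rw [hν.eq_of_length h]

/-- The generating relation of the Bruhat order. -/
def ReflectionLT (y x : W) : Prop :=
  ∃ t, cs.IsReflection t ∧ y = x * t ∧ cs.length y < cs.length x

/-- Each downward reflection deletes one letter by strong exchange. The word may be arbitrary, so
the deletions can be iterated without restoring reducedness. -/
theorem exists_sublist_of_reflectionLT_chain {y x : W}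
    (h : Relation.ReflTransGen (ReflectionLT cs) y x) (ω : List B) (hω : cs.wordProd ω = x) :
    ∃ ν : List B, ν.Sublist ω ∧ cs.wordProd ν = y := by
  induction h generalizing ω with
  | refl => exact ⟨ω, List.Sublist.refl _, hω⟩
  | tail _ hstep ih =>
    obtain ⟨t, ht, rfl, hlt⟩ := hstep
    subst hω
    obtain ⟨j, -, hj⟩ := exists_eraseIdx_of_length_mul_lt cs ω ht hlt
    obtain ⟨ν, hν, hν'⟩ := ih _ hj
    exact ⟨ν, hν.trans (List.eraseIdx_sublist ω j), hν'⟩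

theorem reflectionLT_mul_simple {x : W} {j : B} (h : cs.length x < cs.length (x * cs.simple j)) :
    ReflectionLT cs x (x * cs.simple j) :=
  ⟨cs.simple j, cs.isReflection_simple j, by simp, h⟩

theorem ReflectionLT.lift {y x : W} (h : ReflectionLT cs y x) (j : B) :
    ReflectionLT cs (y * cs.simple j) (x * cs.simple j) ∨ y * cs.simple j = x := by
  obtain ⟨t, ht, rfl, hlt⟩ := h
  have hr : cs.IsReflection (cs.simple j * t * cs.simple j) := by
    simpa using ht.conj (cs.simple j)
  have e : x * t * cs.simple j = x * cs.simple j * (cs.simple j * t * cs.simple j) := by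
    simp [mul_assoc]
  have e' : x * cs.simple j = x * t * cs.simple j * (cs.simple j * t * cs.simple j) := by
    rw [e, mul_assoc, hr.mul_self, mul_one]
  by_cases hlt' : cs.length (x * t * cs.simple j) < cs.length (x * cs.simple j)
  · exact Or.inl ⟨_, hr, e, hlt'⟩
  · right
    have hne : cs.length (x * t * cs.simple j) ≠ cs.length (x * cs.simple j) := by
      rw [e]
      exact hr.length_mul_left_ne _
    obtain ⟨ω, hω, hωp⟩ := cs.exists_isReduced (x * t)
    have hp : cs.wordProd (ω ++ [j]) = x * t * cs.simple j := by
      rw [cs.wordProd_append, cs.wordProd_singleton, hωp]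
    -- Exchange deletes a letter of a word for x t s. Deleting inside `ω` would give a word for x
    -- shorter than ℓ(xt) < ℓ(x), so the last letter goes, and x t s = x.
    obtain ⟨k, hk, hkp⟩ := exists_eraseIdx_of_length_mul_lt cs (ω ++ [j]) hr
      (by rw [hp, ← e']; omega)
    rw [hp, ← e'] at hkp
    rw [List.length_append, List.length_singleton] at hk
    rcases Nat.lt_or_ge k ω.length with hk' | hk'
    · exfalso
      rw [List.eraseIdx_append_of_lt_length hk', cs.wordProd_append, cs.wordProd_singleton] at hkp
      have hx : cs.wordProd (ω.eraseIdx k) = x := mul_right_cancel hkp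
      have h1 := cs.length_wordProd_le (ω.eraseIdx k)
      rw [hx, List.length_eraseIdx_of_lt hk'] at h1
      have h2 := hω.eq
      rw [← hωp] at h2
      omega
    · have : k = ω.length := by omega
      rw [List.eraseIdx_append_of_length_le hk', this] at hkp
      simp only [Nat.sub_self, List.eraseIdx_cons_zero, List.append_nil] at hkp
      rw [hωp, hkp]
      simp

theorem reflectionLT_chain_mul_simple {y x : W}
    (h : Relation.ReflTransGen (ReflectionLT cs) y x) {j : B}
    (hj : cs.length x < cs.length (x * cs.simple j)) :
    Relation.ReflTransGen (ReflectionLT cs) (y * cs.simple j) (x * cs.simple j) := by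
  -- The second alternative absorbs a step that multiplication by s collapses. The ascent hypothesis
  -- is needed only to finish that case and is cleared before the induction.
  suffices Relation.ReflTransGen (ReflectionLT cs) (y * cs.simple j) (x * cs.simple j) ∨
      Relation.ReflTransGen (ReflectionLT cs) (y * cs.simple j) x by
    exact this.elim id fun h => h.tail (reflectionLT_mul_simple cs hj)
  clear hj
  induction h with
  | refl => exact Or.inl .refl
  | tail _ hstep ih =>
    rename_i z x _
    rcases ih with ih | ih
    · rcases hstep.lift cs j with h | h
      · exact Or.inl (ih.tail h)
      · rw [h] at ih
        exact Or.inr ih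
    · exact Or.inr (ih.tail hstep)

theorem reflectionLT_chain_of_sublist {ω ν : List B} (hω : cs.IsReduced ω) (hν : ν.Sublist ω) :
    Relation.ReflTransGen (ReflectionLT cs) (cs.wordProd ν) (cs.wordProd ω) := by
  induction ω using List.reverseRecOn generalizing ν with
  | nil => rw [List.sublist_nil.mp hν]
  | append_singleton ω j ih =>
    have hω' : cs.IsReduced ω := by simpa using hω.take ω.length
    have hlt : cs.length (cs.wordProd ω) < cs.length (cs.wordProd ω * cs.simple j) := by
      have := hω.eq
      rw [cs.wordProd_append, cs.wordProd_singleton] at this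
      rw [this, hω'.eq]
      simp
    rw [cs.wordProd_append, cs.wordProd_singleton]
    obtain ⟨ν₁, ν₂, rfl, h1, h2⟩ := List.sublist_append_iff.mp hν
    rcases List.sublist_singleton.mp h2 with rfl | rfl
    · rw [List.append_nil]
      exact (ih hω' h1).tail (reflectionLT_mul_simple cs hlt)
    · rw [cs.wordProd_append, cs.wordProd_singleton]
      exact reflectionLT_chain_mul_simple cs (ih hω' h1) hlt

/-- The two hypotheses may use different reduced words for `y`. Reflection chains do not depend on
words, so they are concatenated and converted back to a subword of the word for `x`. -/
theorem BruhatLT.trans {z y x : W} (hzy : BruhatLT cs z y) (hyx : BruhatLT cs y x) :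
    BruhatLT cs z x := by
  have hl := (hzy.length_lt cs).trans (hyx.length_lt cs)
  obtain ⟨-, ω₁, ν₁, hω₁, rfl, hν₁, -, rfl⟩ := hzy
  obtain ⟨-, ω, ν, hω, rfl, hν, -, hp⟩ := hyx
  have hchain := (reflectionLT_chain_of_sublist cs hω₁ hν₁).trans
    (hp ▸ reflectionLT_chain_of_sublist cs hω hν)
  obtain ⟨μ, hμ, hμp⟩ := exists_sublist_of_reflectionLT_chain cs hchain ω rfl
  obtain ⟨μ', hμ', hred, hμp'⟩ := exists_isReduced_sublist cs μ
  refine ⟨fun h => by rw [h] at hl; omega, ω, μ', hω, rfl, hμ'.trans hμ, hred, hμp'.trans hμp⟩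

/-! ### The bar involution of the Hecke algebra -/

theorem qBar_qParam : qBar qParam = -qParam := by
  change LaurentPolynomial.invert qParam = -qParam
  rw [qParam, map_sub, LaurentPolynomial.invert_T, LaurentPolynomial.invert_T, neg_neg, neg_sub]

/-- Right multiplication by `H_s⁻¹`. -/
def rightInvOp (i : B) : HeckeAlgebra cs →ₗ[Scalars] HeckeAlgebra cs :=
  rightOp cs i - qParam • LinearMap.id

theorem rightInvOp_apply (i : B) (h : HeckeAlgebra cs) :
    rightInvOp cs i h = rightOp cs i h - qParam • h := rfl

theorem rightOp_rightOp (i : B) (h : HeckeAlgebra cs) :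
    rightOp cs i (rightOp cs i h) = h + qParam • rightOp cs i h := by
  rw [← mul_simple, ← mul_simple, mul_assoc, stdElt_mul_simple cs _ i (by simp),
    cs.simple_mul_simple_self, stdElt_one, mul_add, mul_one, mul_smul_comm]

theorem rightOp_rightInvOp (i : B) (h : HeckeAlgebra cs) :
    rightOp cs i (rightInvOp cs i h) = h := by
  rw [rightInvOp_apply, map_sub, map_smul, rightOp_rightOp, add_sub_cancel_right]

theorem rightInvOp_rightOp (i : B) (h : HeckeAlgebra cs) :
    rightInvOp cs i (rightOp cs i h) = h := by
  rw [rightInvOp_apply, rightOp_rightOp, add_sub_cancel_right]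

theorem rightOp_stdElt_of_lt {x : W} {i : B} (h : cs.length x < cs.length (x * cs.simple i)) :
    rightOp cs i (stdElt cs x) = stdElt cs (x * cs.simple i) := by
  rw [rightOp_stdElt, if_pos h]

theorem bar_stdElt (x : W) : bar cs (stdElt cs x) = Ring.inverse (stdElt cs x⁻¹) := by
  have := bar_smul_stdElt cs 1 x
  rwa [one_smul, map_one, one_smul] at this

theorem bar_stdElt_one : bar cs (stdElt cs 1) = stdElt cs 1 := by
  rw [bar_stdElt, inv_one, stdElt_one, Ring.inverse_one]

theorem bar_stdElt_mul_simple {x : W} {i : B}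
    (h : cs.length x < cs.length (x * cs.simple i)) :
    bar cs (stdElt cs (x * cs.simple i)) = rightInvOp cs i (bar cs (stdElt cs x)) := by
  have hl : cs.length (x * cs.simple i) = cs.length x + 1 :=
    (cs.length_mul_simple x i).resolve_right (by omega)
  have hinv : (x * cs.simple i)⁻¹ = cs.simple i * x⁻¹ := by rw [mul_inv_rev, cs.inv_simple]
  have hmul := stdElt_mul_of_length cs (cs.simple i) x⁻¹ (by
    rw [← hinv, cs.length_inv, cs.length_inv, cs.length_simple, hl, add_comm])
  have hx := isUnit_stdElt cs x⁻¹
  have hs := isUnit_stdElt_simple cs i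
  rw [bar_stdElt, bar_stdElt, hinv, ← hmul, ← rightInvOp_rightOp cs i (Ring.inverse _)]
  congr 1
  rw [← mul_simple]
  refine hx.mul_left_inj.mp ?_
  rw [mul_assoc, Ring.inverse_mul_cancel _ (hs.mul hx), Ring.inverse_mul_cancel _ hx]

/-- The only multiplicativity of the bar that is needed. The descent case follows from the ascent x
s → x, because q⁻¹ - q changes sign under the bar. -/
theorem bar_rightOp (i : B) (h : HeckeAlgebra cs) :
    bar cs (rightOp cs i h) = rightInvOp cs i (bar cs h) := by
  suffices (bar cs).comp (rightOp cs i) = (rightInvOp cs i).comp (bar cs) from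
    LinearMap.congr_fun this h
  refine (stdBasis cs).ext fun x => ?_
  change bar cs (rightOp cs i (stdElt cs x)) = rightInvOp cs i (bar cs (stdElt cs x))
  by_cases hx : cs.length x < cs.length (x * cs.simple i)
  · rw [rightOp_stdElt_of_lt cs hx, bar_stdElt_mul_simple cs hx]
  · have hne := cs.length_mul_simple_ne x i
    have hy : cs.length (x * cs.simple i) < cs.length (x * cs.simple i * cs.simple i) := by
      rw [cs.simple_mul_simple_cancel_right]
      omega
    have hbar := bar_stdElt_mul_simple cs hy
    rw [cs.simple_mul_simple_cancel_right] at hbar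
    rw [rightOp_stdElt, if_neg hx, map_add, LinearMap.map_smulₛₗ, qBar_qParam, neg_smul,
      ← sub_eq_add_neg, hbar, rightInvOp_apply cs i (rightInvOp cs i _), rightOp_rightInvOp]

theorem bar_bar (h : HeckeAlgebra cs) : bar cs (bar cs h) = h := by
  have key : ∀ (n : ℕ) (x : W), cs.length x = n → bar cs (bar cs (stdElt cs x)) = stdElt cs x := by
    intro n
    induction n with
    | zero =>
      intro x hx
      rw [cs.length_eq_zero_iff.mp hx, bar_stdElt_one, bar_stdElt_one]
    | succ n ih =>
      intro x hx
      have hne : x ≠ 1 := by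
        rintro rfl
        simp at hx
      obtain ⟨i, hi⟩ := cs.exists_rightDescent_of_ne_one hne
      have hi' := cs.isRightDescent_iff.mp hi
      have hr : rightOp cs i (stdElt cs (x * cs.simple i)) = stdElt cs x := by
        rw [rightOp_stdElt_of_lt cs (by simp; omega), cs.simple_mul_simple_cancel_right]
      rw [← hr, bar_rightOp, rightInvOp_apply, map_sub, LinearMap.map_smulₛₗ, qBar_qParam,
        bar_rightOp, ih _ (by omega), rightInvOp_apply, neg_smul, sub_neg_eq_add, sub_add_cancel]
  rw [← (stdBasis cs).linearCombination_repr h, Finsupp.linearCombination_apply, Finsupp.sum,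
    map_sum, map_sum]
  refine Finset.sum_congr rfl fun x _ => ?_
  rw [LinearMap.map_smulₛₗ, LinearMap.map_smulₛₗ, qBar_qBar]
  exact congrArg _ (key _ x rfl)

/-- The span of the `H_x` for which `x` is the product of a proper subword of `ω`. -/
def properSubwordSpan (ω : List B) : Submodule Scalars (HeckeAlgebra cs) :=
  Submodule.span Scalars
    (stdElt cs '' {x | ∃ ν : List B, ν.Sublist ω ∧ ν.length < ω.length ∧ cs.wordProd ν = x})

theorem stdElt_mem_properSubwordSpan {ω ν : List B} (h : ν.Sublist ω)
    (hlt : ν.length < ω.length) : stdElt cs (cs.wordProd ν) ∈ properSubwordSpan cs ω :=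
  Submodule.subset_span ⟨_, ⟨ν, h, hlt, rfl⟩, rfl⟩

theorem rightInvOp_mem_properSubwordSpan {ω : List B} (i : B) {h : HeckeAlgebra cs}
    (hh : h ∈ properSubwordSpan cs ω) : rightInvOp cs i h ∈ properSubwordSpan cs (ω ++ [i]) := by
  suffices properSubwordSpan cs ω ≤ (properSubwordSpan cs (ω ++ [i])).comap (rightInvOp cs i) from
    this hh
  refine Submodule.span_le.mpr ?_
  rintro _ ⟨_, ⟨ν, hν, hlt, rfl⟩, rfl⟩
  change rightInvOp cs i (stdElt cs (cs.wordProd ν)) ∈ properSubwordSpan cs (ω ++ [i])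
  have h1 : stdElt cs (cs.wordProd ν) ∈ properSubwordSpan cs (ω ++ [i]) :=
    stdElt_mem_properSubwordSpan cs (hν.trans (List.sublist_append_left _ _))
      (by rw [List.length_append, List.length_singleton]; omega)
  have h2 : stdElt cs (cs.wordProd ν * cs.simple i) ∈ properSubwordSpan cs (ω ++ [i]) := by
    have := stdElt_mem_properSubwordSpan cs (hν.append (List.Sublist.refl [i]))
      (by rw [List.length_append, List.length_append, List.length_singleton]; omega)
    rwa [cs.wordProd_append, cs.wordProd_singleton] at this
  rw [rightInvOp_apply, rightOp_stdElt]
  refine Submodule.sub_mem _ ?_ (Submodule.smul_mem _ _ h1)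
  split_ifs
  · exact h2
  · exact Submodule.add_mem _ h2 (Submodule.smul_mem _ _ h1)

/-- Appending s applies H_s⁻¹ on the right. On the leading term H_ω this gives H_{ωs} - (q⁻¹ -
q)H_ω, whose second term belongs to the proper subword ω. -/
theorem bar_stdElt_sub_mem_properSubwordSpan {ω : List B} (hω : cs.IsReduced ω) :
    bar cs (stdElt cs (cs.wordProd ω)) - stdElt cs (cs.wordProd ω) ∈ properSubwordSpan cs ω := by
  induction ω using List.reverseRecOn with
  | nil =>
    rw [cs.wordProd_nil, bar_stdElt_one, sub_self]
    exact Submodule.zero_mem _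
  | append_singleton ω i ih =>
    have hω' : cs.IsReduced ω := by simpa using hω.take ω.length
    have hlt : cs.length (cs.wordProd ω) < cs.length (cs.wordProd ω * cs.simple i) := by
      have := hω.eq
      rw [cs.wordProd_append, cs.wordProd_singleton] at this
      rw [this, hω'.eq]
      simp
    rw [cs.wordProd_append, cs.wordProd_singleton, bar_stdElt_mul_simple cs hlt]
    have h1 := rightInvOp_mem_properSubwordSpan cs i (ih hω')
    have h2 : stdElt cs (cs.wordProd ω) ∈ properSubwordSpan cs (ω ++ [i]) :=
      stdElt_mem_properSubwordSpan cs (List.sublist_append_left _ _) (by simp)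
    rw [map_sub, rightInvOp_apply cs i (stdElt cs _), rightOp_stdElt_of_lt cs hlt] at h1
    have := Submodule.sub_mem _ h1 (Submodule.smul_mem _ qParam h2)
    rwa [← sub_add, add_sub_cancel_right] at this

/-- The bar involution is unitriangular for the Bruhat order. -/
theorem bruhatLT_of_repr_bar_sub_ne_zero (x y : W)
    (h : (stdBasis cs).repr (bar cs (stdElt cs x) - stdElt cs x) y ≠ 0) : BruhatLT cs y x := by
  classical
  obtain ⟨ω, hω, rfl⟩ := cs.exists_isReduced x
  by_contra hn
  refine h ?_
  suffices properSubwordSpan cs ω ≤ LinearMap.ker ((stdBasis cs).coord y) from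
    this (bar_stdElt_sub_mem_properSubwordSpan cs hω)
  refine Submodule.span_le.mpr ?_
  rintro _ ⟨_, ⟨ν, hν, hlt, rfl⟩, rfl⟩
  change (stdBasis cs).repr (stdBasis cs (cs.wordProd ν)) y = 0
  rw [Module.Basis.repr_self, Finsupp.single_apply, if_neg]
  rintro rfl
  exact hn (bruhatLT_of_sublist cs hω hν hlt)

theorem length_lt_of_repr_bar_sub_ne_zero (x y : W)
    (h : (stdBasis cs).repr (bar cs (stdBasis cs x) - stdBasis cs x) y ≠ 0) :
    cs.length y < cs.length x :=
  (bruhatLT_of_repr_bar_sub_ne_zero cs x y h).length_lt cs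

/-! ### The canonical basis of the Hecke algebra -/

theorem existsUnique_isCanonical [Finite W] (x : W) : ∃! b, IsCanonical cs x b := by
  obtain ⟨c, hc, hc'⟩ := exists_selfDual (stdBasis cs) (bar cs) (bar_bar cs) cs.length
    (fun y x => cs.length y < cs.length x) (fun _ _ h => h) (fun _ _ _ h h' => h.trans h')
    (length_lt_of_repr_bar_sub_ne_zero cs) x
  refine ⟨c, ⟨hc, fun y => (hc' y).1⟩, fun d hd => sub_eq_zero.mp ?_⟩
  refine eq_zero_of_selfDual (stdBasis cs) (bar cs) cs.length
    (length_lt_of_repr_bar_sub_ne_zero cs) (d - c) (by rw [map_sub, hc, hd.1]) fun y => ?_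
  rw [← sub_sub_sub_cancel_right d c (stdElt cs x), map_sub, Finsupp.sub_apply]
  exact sub_mem_negPart (hd.2 y) (hc' y).1

/-! ### The bar involution of the dual -/

/-- The bar involution of the dual as a semilinear map. -/
def dualBarMap : Module.Dual Scalars (HeckeAlgebra cs) →ₛₗ[qBar]
    Module.Dual Scalars (HeckeAlgebra cs) where
  toFun := dualBar cs
  map_add' f g := LinearMap.ext fun h => map_add qBar (f (bar cs h)) (g (bar cs h))
  map_smul' c f := LinearMap.ext fun h => map_mul qBar c (f (bar cs h))

theorem dualBar_apply (f : Module.Dual Scalars (HeckeAlgebra cs)) (h : HeckeAlgebra cs) :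
    dualBar cs f h = qBar (f (bar cs h)) := rfl

theorem dualBarMap_apply (f : Module.Dual Scalars (HeckeAlgebra cs)) :
    dualBarMap cs f = dualBar cs f := rfl

theorem dualBar_dualBar (f : Module.Dual Scalars (HeckeAlgebra cs)) :
    dualBar cs (dualBar cs f) = f :=
  LinearMap.ext fun h => by rw [dualBar_apply, dualBar_apply, qBar_qBar, bar_bar]

theorem dualBar_comp_rightOp (f : Module.Dual Scalars (HeckeAlgebra cs)) (i : B) :
    dualBar cs (f ∘ₗ rightInvOp cs i) = dualBar cs f ∘ₗ rightOp cs i :=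
  LinearMap.ext fun h => by
    rw [dualBar_apply, LinearMap.comp_apply, LinearMap.comp_apply, dualBar_apply, bar_rightOp]

section Finite

variable [Finite W]

theorem dualStdBasis_apply_eq (w : W) (h : HeckeAlgebra cs) :
    dualStdBasis cs w h = (-1) ^ cs.length w * (stdBasis cs).repr h w := by
  classical
  have : dualStdBasis cs w = ((-1) ^ cs.length w : Scalars) • (stdBasis cs).coord w := by
    refine (stdBasis cs).ext fun x => ?_
    change dualStdBasis cs w (stdElt cs x) = _
    rw [dualStdBasis_apply, LinearMap.smul_apply, Module.Basis.coord_apply,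
      Module.Basis.repr_self, Finsupp.single_apply, smul_eq_mul, mul_ite, mul_one, mul_zero]
    simp only [eq_comm]
  rw [this]
  rfl

theorem dualStdBasis_repr_apply (f : Module.Dual Scalars (HeckeAlgebra cs)) (v : W) :
    (dualStdBasis cs).repr f v = (-1) ^ cs.length v * f (stdElt cs v) := by
  classical
  have := Fintype.ofFinite W
  conv_rhs => rw [← (dualStdBasis cs).sum_repr f]
  rw [LinearMap.sum_apply, Finset.sum_eq_single v]
  · rw [LinearMap.smul_apply, dualStdBasis_apply, if_pos rfl, smul_eq_mul, mul_left_comm,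
      ← mul_pow, neg_one_mul, neg_neg, one_pow, mul_one]
  · intro w _ hw
    rw [LinearMap.smul_apply, dualStdBasis_apply, if_neg hw, smul_zero]
  · simp

/-- The dual bar matrix is the signed, barred transpose of the bar matrix, so its triangularity is
inherited with the order reversed. -/
theorem repr_dualBar_sub (w v : W) :
    (dualStdBasis cs).repr (dualBarMap cs (dualStdBasis cs w) - dualStdBasis cs w) v =
      (-1) ^ cs.length v * ((-1) ^ cs.length w *
        qBar ((stdBasis cs).repr (bar cs (stdElt cs v) - stdElt cs v) w)) := by
  classical
  rw [dualStdBasis_repr_apply, LinearMap.sub_apply, dualBarMap_apply, dualBar_apply,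
    dualStdBasis_apply_eq, dualStdBasis_apply_eq, map_mul, map_pow, map_neg, map_one, ← mul_sub,
    map_sub, Finsupp.sub_apply, map_sub]
  congr 3
  rw [stdElt, Module.Basis.repr_self, Finsupp.single_apply]
  split_ifs <;> simp

theorem bruhatLT_of_repr_dualBar_sub_ne_zero (w v : W)
    (h : (dualStdBasis cs).repr (dualBarMap cs (dualStdBasis cs w) - dualStdBasis cs w) v ≠ 0) :
    BruhatLT cs w v := by
  refine bruhatLT_of_repr_bar_sub_ne_zero cs v w fun h0 => h ?_
  rw [repr_dualBar_sub, h0, map_zero, mul_zero, mul_zero]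

end Finite

/-! ### Colength, the longest element and coefficients of right multiplication -/

theorem colength_lt_of_bruhatLT {w₀ : W} (hw₀ : ∀ w, cs.length w ≤ cs.length w₀) {w v : W}
    (h : BruhatLT cs w v) : cs.length w₀ - cs.length v < cs.length w₀ - cs.length w := by
  have := h.length_lt cs
  have := hw₀ v
  omega

theorem longest_mul_self {w₀ : W} (hw₀ : ∀ w, cs.length w ≤ cs.length w₀) : w₀ * w₀ = 1 := by
  by_contra hne
  obtain ⟨j, hj⟩ := cs.exists_rightDescent_of_ne_one hne
  -- A right descent of w₀w₀ would be a right ascent of w₀.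
  have := (length_longest_mul_mul_simple_lt_iff cs hw₀ w₀ j).mp hj
  have := hw₀ (w₀ * cs.simple j)
  omega

theorem repr_rightOp (i : B) (h : HeckeAlgebra cs) (w : W) :
    (stdBasis cs).repr (rightOp cs i h) w = (stdBasis cs).repr h (w * cs.simple i) +
      if cs.length (w * cs.simple i) < cs.length w then qParam * (stdBasis cs).repr h w else 0 := by
  classical
  suffices (stdBasis cs).coord w ∘ₗ rightOp cs i = (stdBasis cs).coord (w * cs.simple i) +
      (if cs.length (w * cs.simple i) < cs.length w then qParam else 0) •
        (stdBasis cs).coord w by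
    have := LinearMap.congr_fun this h
    refine this.trans ?_
    rw [LinearMap.add_apply, LinearMap.smul_apply, smul_eq_mul, ite_mul, zero_mul]
    rfl
  refine (stdBasis cs).ext fun x => ?_
  have hne := cs.length_mul_simple_ne x i
  have e : x * cs.simple i = w ↔ x = w * cs.simple i := by
    constructor <;> rintro rfl <;> simp
  rw [LinearMap.comp_apply, LinearMap.add_apply, LinearMap.smul_apply]
  change (stdBasis cs).coord w (rightOp cs i (stdElt cs x)) = _
  rw [rightOp_stdElt]
  split_ifs with h1 h2 h2 <;>
    simp only [stdElt, map_add, map_smul, Module.Basis.coord_apply, Module.Basis.repr_self,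
      Finsupp.single_apply, e, zero_smul]
  · rw [if_neg (c := x = w)]
    · simp
    · rintro rfl
      omega
  · simp
  · rw [if_neg (c := x = w)]
    · simp
    · rintro rfl
      omega

section Finite

variable [Finite W]

/-! ### The canonical basis of the dual -/

theorem existsUnique_isDualCanonical {w₀ : W} (hw₀ : ∀ w, cs.length w ≤ cs.length w₀) (w : W) :
    ∃! d, IsDualCanonical cs w d := by
  obtain ⟨c, hc, hc'⟩ := exists_selfDual (dualStdBasis cs) (dualBarMap cs) (dualBar_dualBar cs)
    (fun v => cs.length w₀ - cs.length v) (fun v w => BruhatLT cs w v)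
    (fun _ _ => colength_lt_of_bruhatLT cs hw₀) (fun _ _ _ h h' => h'.trans cs h)
    (bruhatLT_of_repr_dualBar_sub_ne_zero cs) w
  refine ⟨c, ⟨hc, fun v => ⟨fun _ => (hc' v).1, (hc' v).2⟩⟩, fun d hd => sub_eq_zero.mp ?_⟩
  refine eq_zero_of_selfDual (dualStdBasis cs) (dualBarMap cs)
    (fun v => cs.length w₀ - cs.length v) (fun w v h => colength_lt_of_bruhatLT cs hw₀
      (bruhatLT_of_repr_dualBar_sub_ne_zero cs w v h)) (d - c)
    (by rw [map_sub, hc, dualBarMap_apply, hd.1]) fun v => ?_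
  rw [← sub_sub_sub_cancel_right d c (dualStdBasis cs w), map_sub, Finsupp.sub_apply]
  refine sub_mem_negPart ?_ (hc' v).1
  by_cases hv : BruhatLT cs w v
  · exact (hd.2 v).1 hv
  · rw [(hd.2 v).2 hv]
    exact zero_mem_negPart

theorem IsDualCanonical.repr_sub_mem_negPart {w : W}
    {d : Module.Dual Scalars (HeckeAlgebra cs)} (hd : IsDualCanonical cs w d) (v : W) :
    (dualStdBasis cs).repr (d - dualStdBasis cs w) v ∈ negPart := by
  by_cases hv : BruhatLT cs w v
  · exact (hd.2 v).1 hv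
  · rw [(hd.2 v).2 hv]
    exact zero_mem_negPart

/-! ### Flipping the canonical basis -/

theorem dualIdent_flip_stdElt (u x : W) :
    dualIdent cs (flip cs u (stdElt cs x)) = dualStdBasis cs (u * x) := by
  rw [← dualIdent_stdElt]
  exact congrArg _ ((stdBasis cs).constr_basis Scalars _ x)

theorem repr_dualIdent_flip (u : W) (h : HeckeAlgebra cs) (v : W) :
    (dualStdBasis cs).repr (dualIdent cs (flip cs u h)) v = (stdBasis cs).repr h (u⁻¹ * v) := by
  classical
  suffices (dualStdBasis cs).coord v ∘ₗ (dualIdent cs).toLinearMap ∘ₗ flip cs u =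
      (stdBasis cs).coord (u⁻¹ * v) from LinearMap.congr_fun this h
  refine (stdBasis cs).ext fun x => ?_
  change (dualStdBasis cs).repr (dualIdent cs (flip cs u (stdElt cs x))) v =
    (stdBasis cs).repr (stdBasis cs x) (u⁻¹ * v)
  rw [dualIdent_flip_stdElt, Module.Basis.repr_self, Module.Basis.repr_self,
    Finsupp.single_apply, Finsupp.single_apply]
  simp only [eq_inv_mul_iff_mul_eq]

/-- At an ascent of x, w₀x has a descent, and the q⁻¹ - q term of H_s cancels against the one in
H_s⁻¹; at a descent of x the term survives on both sides. The minus sign comes from the length of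
w₀x changing by one. -/
theorem dualIdent_flip_rightOp {w₀ : W} (hw₀ : ∀ w, cs.length w ≤ cs.length w₀) (i : B)
    (h : HeckeAlgebra cs) : dualIdent cs (flip cs w₀ (rightOp cs i h)) =
      -(dualIdent cs (flip cs w₀ h) ∘ₗ rightInvOp cs i) := by
  suffices (dualIdent cs).toLinearMap ∘ₗ flip cs w₀ ∘ₗ rightOp cs i =
      -((LinearMap.lcomp Scalars Scalars (rightInvOp cs i)) ∘ₗ
        (dualIdent cs).toLinearMap ∘ₗ flip cs w₀) from LinearMap.congr_fun this h
  refine (stdBasis cs).ext fun x => LinearMap.ext fun g => ?_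
  change dualIdent cs (flip cs w₀ (rightOp cs i (stdElt cs x))) g =
    -(dualIdent cs (flip cs w₀ (stdElt cs x)) (rightInvOp cs i g))
  have hiff := length_longest_mul_mul_simple_lt_iff cs hw₀ x i
  have hsign : (-1 : Scalars) ^ cs.length (w₀ * x * cs.simple i) =
      -(-1) ^ cs.length (w₀ * x) := by
    rcases cs.length_mul_simple (w₀ * x) i with h | h
    · rw [h, pow_succ, mul_neg_one]
    · rw [← h, pow_succ, mul_neg_one, neg_neg]
  rw [rightOp_stdElt, dualIdent_flip_stdElt, rightInvOp_apply, dualStdBasis_apply_eq, map_sub,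
    map_smul, Finsupp.sub_apply, Finsupp.smul_apply, repr_rightOp, smul_eq_mul]
  by_cases hx : cs.length x < cs.length (x * cs.simple i)
  · rw [if_pos hx, if_pos (hiff.mpr hx), dualIdent_flip_stdElt, dualStdBasis_apply_eq, ← mul_assoc,
      hsign]
    ring
  · rw [if_neg hx, if_neg (fun h => hx (hiff.mp h)), map_add, map_add, map_smul, map_smul,
      dualIdent_flip_stdElt, dualIdent_flip_stdElt, LinearMap.add_apply, LinearMap.smul_apply,
      dualStdBasis_apply_eq, dualStdBasis_apply_eq, ← mul_assoc w₀, hsign, smul_eq_mul]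
    ring

/-- Base case for the intertwining of the bars: nothing lies above w₀ in the Bruhat order. -/
theorem dualBar_dualStdBasis_longest {w₀ : W} (hw₀ : ∀ w, cs.length w ≤ cs.length w₀) :
    dualBar cs (dualStdBasis cs w₀) = dualStdBasis cs w₀ := by
  rw [← sub_eq_zero]
  refine (dualStdBasis cs).ext_elem fun v => ?_
  rw [map_zero]
  by_contra h
  have := (bruhatLT_of_repr_dualBar_sub_ne_zero cs w₀ v h).length_lt cs
  have := hw₀ v
  omega

/-- The flip intertwines the two bar involutions. -/
theorem dualBar_dualIdent_flip {w₀ : W} (hw₀ : ∀ w, cs.length w ≤ cs.length w₀)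
    (h : HeckeAlgebra cs) :
    dualBar cs (dualIdent cs (flip cs w₀ h)) = dualIdent cs (flip cs w₀ (bar cs h)) := by
  have key : ∀ (n : ℕ) (x : W), cs.length x = n →
      dualBar cs (dualIdent cs (flip cs w₀ (stdElt cs x))) =
        dualIdent cs (flip cs w₀ (bar cs (stdElt cs x))) := by
    intro n
    induction n with
    | zero =>
      intro x hx
      rw [cs.length_eq_zero_iff.mp hx, bar_stdElt_one, dualIdent_flip_stdElt, mul_one,
        dualBar_dualStdBasis_longest cs hw₀]
    | succ n ih =>
      intro x hx
      have hne : x ≠ 1 := by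
        rintro rfl
        simp at hx
      obtain ⟨i, hi⟩ := cs.exists_rightDescent_of_ne_one hne
      have hi' := cs.isRightDescent_iff.mp hi
      have hr : rightOp cs i (stdElt cs (x * cs.simple i)) = stdElt cs x := by
        rw [rightOp_stdElt_of_lt cs (by simp; omega), cs.simple_mul_simple_cancel_right]
      set g := stdElt cs (x * cs.simple i)
      -- Applied to ḡH_s⁻¹, the intertwining relation expresses the image of ḡ through that of
      -- ḡH_s⁻¹, the element to be reached.
      have h2 := dualIdent_flip_rightOp cs hw₀ i (rightInvOp cs i (bar cs g))
      rw [rightOp_rightInvOp] at h2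
      rw [← hr, bar_rightOp, dualIdent_flip_rightOp cs hw₀, ← dualBarMap_apply, map_neg,
        dualBarMap_apply, dualBar_comp_rightOp, ih _ (by omega), h2]
      refine LinearMap.ext fun v => ?_
      change - -(dualIdent cs (flip cs w₀ (rightInvOp cs i (bar cs g)))
        (rightInvOp cs i (rightOp cs i v))) = _
      rw [rightInvOp_rightOp, neg_neg]
  suffices (dualBarMap cs).comp ((dualIdent cs).toLinearMap ∘ₗ flip cs w₀) =
      ((dualIdent cs).toLinearMap ∘ₗ flip cs w₀).comp (bar cs) from LinearMap.congr_fun this h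
  exact (stdBasis cs).ext fun x => key _ x rfl

/-- The difference is self-dual with coefficients in q⁻¹ℤ[q⁻¹], hence zero. No Bruhat support
condition on `b` is required; that of `d` serves only to place its coefficients there. -/
theorem dualIdent_flip_canonical {w₀ : W} (hw₀ : ∀ w, cs.length w ≤ cs.length w₀) {w : W}
    {b : HeckeAlgebra cs} (hb : IsCanonical cs (w₀ * w) b)
    {d : Module.Dual Scalars (HeckeAlgebra cs)} (hd : IsDualCanonical cs w d) :
    dualIdent cs (flip cs w₀ b) = d := by
  refine sub_eq_zero.mp (eq_zero_of_selfDual (dualStdBasis cs) (dualBarMap cs)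
    (fun v => cs.length w₀ - cs.length v) (fun w v h => colength_lt_of_bruhatLT cs hw₀
      (bruhatLT_of_repr_dualBar_sub_ne_zero cs w v h)) _ ?_ fun v => ?_)
  · rw [map_sub, dualBarMap_apply, dualBarMap_apply, hd.1, dualBar_dualIdent_flip cs hw₀, hb.1]
  · have hw : dualIdent cs (flip cs w₀ (stdElt cs (w₀ * w))) = dualStdBasis cs w := by
      rw [dualIdent_flip_stdElt, ← mul_assoc, longest_mul_self cs hw₀, one_mul]
    rw [← sub_sub_sub_cancel_right _ d (dualStdBasis cs w), map_sub, Finsupp.sub_apply]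
    refine sub_mem_negPart ?_ (hd.repr_sub_mem_negPart cs v)
    rw [← hw, ← map_sub, ← map_sub, repr_dualIdent_flip]
    exact hb.2 _

/-! ### The pairing of the two canonical bases -/

theorem pairing_eq_dualIdent (a b : HeckeAlgebra cs) : pairing cs a b = dualIdent cs a b := by
  classical
  suffices pairing cs = (dualIdent cs).toLinearMap from
    LinearMap.congr_fun (LinearMap.congr_fun this a) b
  refine (stdBasis cs).ext fun x => (stdBasis cs).ext fun y => ?_
  change pairing cs (stdBasis cs x) (stdBasis cs y) = dualIdent cs (stdElt cs x) (stdElt cs y)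
  rw [dualIdent_stdElt, dualStdBasis_apply, pairing, Module.Basis.constr_basis,
    Module.Basis.constr_basis]

/-- The two canonical bases are dual to each other up to sign. -/
theorem dualCanonical_apply_canonical [DecidableEq W] {w x : W} {b : HeckeAlgebra cs}
    (hb : IsCanonical cs x b) {d : Module.Dual Scalars (HeckeAlgebra cs)}
    (hd : IsDualCanonical cs w d) : d b = if x = w then (-1) ^ cs.length x else 0 := by
  have := Fintype.ofFinite W
  set n := d - dualStdBasis cs w with hn
  set m := b - stdElt cs x with hm
  have hlead : dualStdBasis cs w (stdElt cs x) = if x = w then (-1) ^ cs.length x else 0 := by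
    rw [dualStdBasis_apply]
    split_ifs with h1 h2 h2
    · rw [h1]
    · exact absurd h1.symm h2
    · exact absurd h2.symm h1
    · rfl
  have hS : ∀ v, dualStdBasis cs v m ∈ negPart := fun v => by
    rw [dualStdBasis_apply_eq]
    exact neg_one_pow_mul_mem_negPart (hb.2 v) _
  have hN : ∀ v, (dualStdBasis cs).repr n v ∈ negPart := hd.repr_sub_mem_negPart cs
  have hnx : n (stdElt cs x) ∈ negPart := by
    have h := dualStdBasis_repr_apply cs n x
    have h' := neg_one_pow_mul_mem_negPart (hN x) (cs.length x)
    rwa [h, ← mul_assoc, ← mul_pow, neg_one_mul, neg_neg, one_pow, one_mul] at h'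
  have hnm : n m ∈ negPart := by
    rw [← (dualStdBasis cs).sum_repr n, LinearMap.sum_apply]
    refine sum_mem_negPart _ fun v _ => ?_
    rw [LinearMap.smul_apply, smul_eq_mul]
    exact mul_mem_negPart (hN v) (hS v)
  have hsplit : d b - dualStdBasis cs w (stdElt cs x) =
      dualStdBasis cs w m + n (stdElt cs x) + n m := by
    rw [hn, hm]
    simp only [LinearMap.sub_apply, map_sub]
    ring
  rw [← hlead]
  -- The leading value is an integer, so the difference is bar-invariant as well as an element of
  -- q⁻¹ℤ[q⁻¹].
  refine sub_eq_zero.mp (eq_zero_of_qBar_eq_of_mem_negPart ?_ ?_)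
  · rw [hsplit]
    exact add_mem_negPart (add_mem_negPart (hS w) hnx) hnm
  · have h1 : qBar (d b) = d b := by
      have := dualBar_apply cs d b
      rwa [hd.1, hb.1, eq_comm] at this
    rw [map_sub, h1, hlead]
    split_ifs
    · rw [map_pow, map_neg, map_one]
    · rw [map_zero]

end Finite

end

end HeckeDuality

theorem mainTheorem7 {B W : Type*} [Group W] [Finite W] [DecidableEq W] {M : CoxeterMatrix B}
    (cs : CoxeterSystem M W) (w₀ : W) (hw₀ : ∀ w, cs.length w ≤ cs.length w₀) :
    (∀ x, ∃! b, HeckeDuality.IsCanonical cs x b) ∧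
    (∀ w, ∃! d, HeckeDuality.IsDualCanonical cs w d) ∧
    ∀ (KL : W → HeckeDuality.HeckeAlgebra cs)
      (D : W → Module.Dual HeckeDuality.Scalars (HeckeDuality.HeckeAlgebra cs)),
      (∀ x, HeckeDuality.IsCanonical cs x (KL x)) →
      (∀ w, HeckeDuality.IsDualCanonical cs w (D w)) →
      (∀ w, HeckeDuality.dualIdent cs (HeckeDuality.flip cs w₀ (KL (w₀ * w))) = D w) ∧
      (∀ w x, HeckeDuality.pairing cs (HeckeDuality.flip cs w₀ (KL (w₀ * w))) (KL x) =
        if x = w then (-1) ^ cs.length x else 0) := by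
  refine ⟨HeckeDuality.existsUnique_isCanonical cs,
    HeckeDuality.existsUnique_isDualCanonical cs hw₀, fun KL D hKL hD => ?_⟩
  have key : ∀ w, HeckeDuality.dualIdent cs (HeckeDuality.flip cs w₀ (KL (w₀ * w))) = D w :=
    fun w => HeckeDuality.dualIdent_flip_canonical cs hw₀ (hKL _) (hD w)
  refine ⟨key, fun w x => ?_⟩
  rw [HeckeDuality.pairing_eq_dualIdent, key]
  exact HeckeDuality.dualCanonical_apply_canonical cs (hKL x) (hD w)
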